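/- Let $F$ be an archimedean local field ($F = \mathbb{R}$ or $F = \mathbb{C}$), let $E/F$ be a quadratic étale algebra (so $E = F \times F$ or $E/F$ is a quadratic field extension) with nontrivial $F$-automorphism $\iota$, and let $V$ be a finitely generated $E$-module with a nondegenerate $\iota$-hermitian form $\langle\,,\rangle$. Let $e \in V$ be such that $Ee$ is free of rank one over $E$ and the form is nondegenerate on $Ee$; let $V_H$ be the orthogonal complement of $Ee$, so $V = V_H \oplus Ee$. Put $G = \mathrm{Aut}(V/E,\langle\,,\rangle)$ and $H = \mathrm{Aut}(V_H/E,\langle\,,\rangle)$, embedded in $G$ by letting it act trivially on $e$. Let $\mathfrak{h} \subseteq \mathfrak{g}$ be the Lie algebras of $H$ and $G$, with centers $\mathfrak{z}_H$ and $\mathfrak{z}$. Let $\mathfrak{g}^\wedge = \mathrm{Hom}_{\mathbb{R}}(\mathfrak{g}, i\mathbb{R})$ and $\mathfrak{h}^\wedge = \mathrm{Hom}_{\mathbb{R}}(\mathfrak{h}, i\mathbb{R})$ be the imaginary duals, with the coadjoint actions (for $x \in \mathfrak{g}$, $\xi \in \mathfrak{g}^\wedge$, $[x,\xi]$ is given by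 $\langle y,[x,\xi]\rangle = -\langle [x,y],\xi\rangle$), and for $\tau \in \mathfrak{g}^\wedge$ write $\tau_H \in \mathfrak{h}^\wedge$ for its restriction to $\mathfrak{h}$. Write $\mathfrak{g}_\tau = \{x \in \mathfrak{g} : [x,\tau]=0\}$ and $\mathfrak{h}_{\tau_H} = \{y \in \mathfrak{h} : [y,\tau_H]=0\}$ for the centralizers. An element of $\mathfrak{g}^\wedge$ or $\mathfrak{h}^\wedge$ is regular if its centralizer, in $\mathfrak{g}$ or $\mathfrak{h}$ respectively, has minimal dimension. An element of $\mathfrak{g}^\wedge$ is stable if its stabilizer in $H$ is finite and its $H$-orbit is Zariski closed in $\mathfrak{g}^\wedge$. **Theorem.** Let $\tau \in \mathfrak{g}^\wedge$ and $0 \neq z \in \mathfrak{z}_H$. The following are equivalent. (i) $\tau$ is stable. (ii) Both $\tau$ and $\tau_H$ are regular, and the bilinear form $$\mathfrak{g}_\tau/\mathfrak{z} \otimes \mathfrak{h}_{\tau_H} \to F, \qquad (x,y) \mapsto \langle [z,[x,y]], \tau \rangle$$ is nondegenerate. Here $\tau$ is identified with the unique $F$-linear form $\ell : \mathfrak{g}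 \to F$ such that $\tau = i\,\mathrm{Re}\,\ell$, and $\langle x, \tau\rangle$ means $\ell(x)$. -/

import Mathlib

/-! ## The imaginary dual of a Lie algebra over `ℝ` or `ℂ` -/

/-- The imaginary dual `𝔨^∧ = Hom_ℝ(𝔨, iℝ)` of an `F`-vector space `𝔨`, where `F` is `ℝ` or `ℂ`:
additive maps `𝔨 → ℂ` that are `ℝ`-linear and take purely imaginary values. -/
@[ext]
structure ImaginaryDual (F 𝔨 : Type*) [RCLike F] [AddCommGroup 𝔨] [Module F 𝔨] where
  toAddMonoidHom : 𝔨 →+ ℂ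
  map_real_smul' : ∀ (r : ℝ) (x : 𝔨), toAddMonoidHom ((r : F) • x) = (r : ℂ) * toAddMonoidHom x
  re_eq_zero' : ∀ x : 𝔨, (toAddMonoidHom x).re = 0

namespace ImaginaryDual

section VectorSpace

variable {F 𝔨 : Type*} [RCLike F] [AddCommGroup 𝔨] [Module F 𝔨]

/-- The canonical pairing `⟨x, ξ⟩ ∈ iℝ ⊆ ℂ`. -/
def pairing (x : 𝔨) (ξ : ImaginaryDual F 𝔨) : ℂ := ξ.toAddMonoidHom x

theorem pairing_add (x y : 𝔨) (ξ : ImaginaryDual F 𝔨) :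
    pairing (x + y) ξ = pairing x ξ + pairing y ξ := map_add _ _ _

theorem pairing_real_smul (r : ℝ) (x : 𝔨) (ξ : ImaginaryDual F 𝔨) :
    pairing ((r : F) • x) ξ = (r : ℂ) * pairing x ξ := ξ.map_real_smul' r x

theorem pairing_re (x : 𝔨) (ξ : ImaginaryDual F 𝔨) : (pairing x ξ).re = 0 := ξ.re_eq_zero' x

@[ext 1100]
theorem ext_pairing {ξ η : ImaginaryDual F 𝔨} (h : ∀ x, pairing x ξ = pairing x η) : ξ = η :=
  ImaginaryDual.ext (AddMonoidHom.ext h)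

/-- The pullback of `ξ` along an `F`-linear map. -/
def comap {𝔩 : Type*} [AddCommGroup 𝔩] [Module F 𝔩] (f : 𝔩 →ₗ[F] 𝔨) (ξ : ImaginaryDual F 𝔨) :
    ImaginaryDual F 𝔩 where
  toAddMonoidHom := ξ.toAddMonoidHom.comp f.toAddMonoidHom
  map_real_smul' r x := by simp [ξ.map_real_smul']
  re_eq_zero' x := ξ.re_eq_zero' _

@[simp]
theorem pairing_comap {𝔩 : Type*} [AddCommGroup 𝔩] [Module F 𝔩] (f : 𝔩 →ₗ[F] 𝔨)
    (ξ : ImaginaryDual F 𝔨) (x : 𝔩) : pairing x (comap f ξ) = pairing (f x) ξ := rfl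

/-- The `F`-valued form of `ξ ∈ 𝔨^∧`: the unique `F`-linear map `ℓ : 𝔨 → F` with
`⟨x, ξ⟩ = i Re (ℓ x)` for all `x`. For `F = ℝ` it is `ξ / i`. The map `ξ ↦ ℓ` identifies
`𝔨^∧` with the `F`-linear dual of `𝔨`. -/
noncomputable def toDual (ξ : ImaginaryDual F 𝔨) : 𝔨 →ₗ[F] F where
  toFun x := ((pairing x ξ).im : F) - RCLike.I * ((pairing ((RCLike.I : F) • x) ξ).im : F)
  map_add' x y := by
    simp only [smul_add, pairing_add, Complex.add_im, RCLike.ofReal_add]; ring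
  map_smul' c x := by
    have key : ∀ (a b : ℝ) (u v : 𝔨), (pairing ((a : F) • u + (b : F) • v) ξ).im
        = a * (pairing u ξ).im + b * (pairing v ξ).im := by
      intro a b u v
      simp [pairing_add, pairing_real_smul]
    have h1 : c • x = ((RCLike.re c : ℝ) : F) • x
        + ((RCLike.im c : ℝ) : F) • ((RCLike.I : F) • x) := by
      rw [smul_smul, ← add_smul, RCLike.re_add_im]
    have h0 := RCLike.I_mul_I (K := F)
    have hc := RCLike.re_add_im c
    rcases h0 with h0 | h0
    · have him : (RCLike.im c : ℝ) = 0 := by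
        rw [← RCLike.I_im' c, h0]; simp
      rw [him] at h1 hc
      simp only [RingHom.id_apply, smul_eq_mul]
      rw [h1]
      simp only [h0, zero_smul, zero_mul, sub_zero, smul_zero, add_zero, pairing_real_smul]
      rw [← hc]
      simp
    · have h2 : (RCLike.I : F) • (c • x) = ((-RCLike.im c : ℝ) : F) • x
          + ((RCLike.re c : ℝ) : F) • ((RCLike.I : F) • x) := by
        rw [smul_smul, smul_smul, ← add_smul]
        congr 1
        conv_lhs => rw [← hc]
        push_cast
        linear_combination (RCLike.im c : F) * h0
      rw [h2, h1, key, key]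
      simp only [RingHom.id_apply, smul_eq_mul]
      conv_rhs => rw [← hc]
      push_cast
      linear_combination
        (RCLike.im c : F) * ((pairing ((RCLike.I : F) • x) ξ).im : F) * h0

theorem re_toDual (ξ : ImaginaryDual F 𝔨) (x : 𝔨) :
    RCLike.re (ξ.toDual x) = (pairing x ξ).im := by
  simp [toDual]

/-- The defining property of `toDual`. -/
theorem pairing_eq (ξ : ImaginaryDual F 𝔨) (x : 𝔨) :
    pairing x ξ = Complex.I * ((RCLike.re (ξ.toDual x) : ℝ) : ℂ) := by
  rw [re_toDual]
  apply Complex.ext <;> simp [pairing_re]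

/-- Zariski closed subsets of `𝔨^∧`, regarded as an affine space over `F`: common zero sets of
families of polynomials, with coefficients in `F`, in the coordinate functions attached to the
elements of `𝔨`. -/
def IsZariskiClosed (Z : Set (ImaginaryDual F 𝔨)) : Prop :=
  ∃ S : Set (MvPolynomial 𝔨 F), Z = {ξ | ∀ p ∈ S, MvPolynomial.eval (fun x => ξ.toDual x) p = 0}

end VectorSpace

section LieAlgebra

variable {F 𝔨 : Type*} [RCLike F] [LieRing 𝔨] [LieAlgebra F 𝔨]

/-- The coadjoint action `[x, ξ]` of `x ∈ 𝔨` on `ξ ∈ 𝔨^∧`: `⟨y, [x, ξ]⟩ = -⟨[x, y], ξ⟩`. -/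
def coad (x : 𝔨) (ξ : ImaginaryDual F 𝔨) : ImaginaryDual F 𝔨 :=
  comap (-(LieAlgebra.ad F 𝔨 x : 𝔨 →ₗ[F] 𝔨)) ξ

theorem pairing_coad (x y : 𝔨) (ξ : ImaginaryDual F 𝔨) :
    pairing y (coad x ξ) = pairing (-⁅x, y⁆) ξ := rfl

/-- `[x, ξ] = 0` iff `ξ` vanishes on `[x, 𝔨]`. -/
theorem coad_eq_zero_iff (x : 𝔨) (ξ : ImaginaryDual F 𝔨) :
    (∀ y, pairing y (coad x ξ) = 0) ↔ ∀ y, pairing ⁅x, y⁆ ξ = 0 := by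
  have h : ∀ y, pairing y (coad x ξ) = -pairing ⁅x, y⁆ ξ := fun y => map_neg ξ.toAddMonoidHom _
  simp only [h, neg_eq_zero]

/-- The centralizer `𝔨_ξ = {x ∈ 𝔨 : [x, ξ] = 0}`. -/
def centralizer (ξ : ImaginaryDual F 𝔨) : Submodule F 𝔨 where
  carrier := {x | ∀ y, pairing y (coad x ξ) = 0}
  zero_mem' := by
    rw [Set.mem_ofPred_eq, coad_eq_zero_iff]
    intro y; simp [pairing]
  add_mem' := by
    intro a b ha hb
    simp only [Set.mem_ofPred_eq, coad_eq_zero_iff] at *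
    intro y
    rw [add_lie, pairing_add, ha, hb, add_zero]
  smul_mem' := by
    intro c a ha
    simp only [Set.mem_ofPred_eq, coad_eq_zero_iff] at *
    intro y
    rw [smul_lie, ← lie_smul, ha]

theorem mem_centralizer_iff (x : 𝔨) (ξ : ImaginaryDual F 𝔨) :
    x ∈ centralizer ξ ↔ ∀ y, pairing ⁅x, y⁆ ξ = 0 := coad_eq_zero_iff x ξ

/-- `ξ` is regular if its centralizer has minimal dimension. -/
def IsRegular (ξ : ImaginaryDual F 𝔨) : Prop :=
  ∀ η : ImaginaryDual F 𝔨, Module.finrank F (centralizer ξ) ≤ Module.finrank F (centralizer η)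

end LieAlgebra

end ImaginaryDual

/-! ## Unitary GGP pairs -/

attribute [local instance 100] LieRing.ofAssociativeRing

/-- The data defining a unitary GGP pair over `F`: the nontrivial automorphism `ι` of `E / F`, a
nondegenerate `ι`-hermitian form on the `E`-module `V`, and a vector `e` for which `E e` is free of
rank one and the form is nondegenerate on `E e`. (That `E / F` is quadratic étale and that `V` is
finitely generated is imposed where this structure is used.) -/
structure UnitaryGGPPair (F E V : Type*) [RCLike F] [CommRing E] [Algebra F E]
    [AddCommGroup V] [Module E V] where
  ι : E ≃ₐ[F] E
  ι_ne_refl : ι ≠ AlgEquiv.refl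
  form : V →ₛₗ[(ι : E →+* E)] V →ₗ[E] E
  hermitian : ∀ v w, ι (form v w) = form w v
  nondegenerate : form.Nondegenerate
  e : V
  free_e : Function.Injective fun a : E => a • e
  nondegenerate_e :
    (form.domRestrict₁₂ (Submodule.span E {e}) (Submodule.span E {e})).Nondegenerate

namespace UnitaryGGPPair

variable {F E V : Type*} [RCLike F] [CommRing E] [Algebra F E]
  [AddCommGroup V] [Module E V] (P : UnitaryGGPPair F E V)

/-- `V_H`, the orthogonal complement of `E e`. -/
def VH : Submodule E V where
  carrier := {v | ∀ u ∈ Submodule.span E {P.e}, P.form u v = 0}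
  zero_mem' := by intro u _; simp
  add_mem' := by
    intro a b ha hb u hu
    rw [map_add, ha u hu, hb u hu, add_zero]
  smul_mem' := by
    intro c a ha u hu
    rw [map_smul, ha u hu, smul_zero]

theorem mem_VH_iff (v : V) : v ∈ P.VH ↔ P.form P.e v = 0 := by
  constructor
  · intro h
    exact h _ (Submodule.mem_span_singleton_self _)
  · intro h u hu
    obtain ⟨a, rfl⟩ := Submodule.mem_span_singleton.1 hu
    simp [h]

/-- The group `G = Aut(V/E, form)`. -/
def G : Subgroup (V ≃ₗ[E] V) where
  carrier := {g | ∀ v w, P.form (g v) (g w) = P.form v w}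
  one_mem' := by intro v w; rfl
  mul_mem' := by
    intro a b ha hb v w
    rw [LinearEquiv.mul_apply, LinearEquiv.mul_apply, ha, hb]
  inv_mem' := by
    intro a ha v w
    have := ha (a⁻¹ v) (a⁻¹ w)
    rw [← LinearEquiv.mul_apply, ← LinearEquiv.mul_apply, mul_inv_cancel] at this
    exact this.symm

/-- The group `H = Aut(V_H/E, form)`, embedded in `G`: the elements of `G` that act on the summands
of `V = V_H ⊕ E e`, trivially on the second one. -/
def H : Subgroup P.G where
  carrier := {g | (∀ v ∈ P.VH, (g : V ≃ₗ[E] V) v ∈ P.VH) ∧ (g : V ≃ₗ[E] V) P.e = P.e}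
  one_mem' := ⟨fun _ h => h, rfl⟩
  mul_mem' := by
    rintro a b ⟨ha, ha'⟩ ⟨hb, hb'⟩
    refine ⟨fun v hv => ha _ (hb v hv), ?_⟩
    rw [Subgroup.coe_mul, LinearEquiv.mul_apply, hb', ha']
  inv_mem' := by
    rintro a ⟨ha, ha'⟩
    have h1 : ((a⁻¹ : P.G) : V ≃ₗ[E] V) P.e = P.e := by
      conv_lhs => rw [← ha']
      rw [← LinearEquiv.mul_apply, ← Subgroup.coe_mul, inv_mul_cancel]
      rfl
    refine ⟨fun v hv => ?_, h1⟩
    rw [mem_VH_iff] at hv ⊢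
    have := (a⁻¹).2 P.e v
    rw [h1] at this
    rw [this, hv]

variable [Module F V] [IsScalarTower F E V]

/-- The Lie algebra `𝔤` of `G`: the skew-hermitian `E`-linear endomorphisms of `V`. -/
def 𝔤 : LieSubalgebra F (Module.End E V) where
  carrier := {x | ∀ v w, P.form (x v) w + P.form v (x w) = 0}
  zero_mem' := by intro v w; simp
  add_mem' := by
    intro a b ha hb v w
    have h1 := ha v w
    have h2 := hb v w
    simp only [LinearMap.add_apply, map_add]
    linear_combination h1 + h2
  smul_mem' := by
    intro c a ha v w
    have h1 := ha v w
    simp only [LinearMap.smul_apply]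
    rw [← algebraMap_smul E c (a v), ← algebraMap_smul E c (a w)]
    simp only [map_smulₛₗ, LinearMap.smul_apply, smul_eq_mul, RingHom.id_apply, RingHom.coe_coe,
      AlgEquiv.commutes]
    linear_combination (algebraMap F E c) * h1
  lie_mem' := by
    intro a b ha hb v w
    have h1 := ha (b v) w
    have h2 := hb (a v) w
    have h3 := ha v (b w)
    have h4 := hb v (a w)
    simp only [Ring.lie_def, LinearMap.sub_apply, Module.End.mul_apply, map_sub]
    linear_combination h1 - h2 + h3 - h4

/-- The Lie algebra `𝔥` of `H`, embedded in `𝔤`: the elements of `𝔤` that act on the summands of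
`V = V_H ⊕ E e`, by zero on the second one. -/
def 𝔥 : LieSubalgebra F P.𝔤 where
  carrier := {x | (∀ v ∈ P.VH, (x : Module.End E V) v ∈ P.VH) ∧ (x : Module.End E V) P.e = 0}
  zero_mem' := ⟨fun _ _ => Submodule.zero_mem _, rfl⟩
  add_mem' := by
    rintro a b ⟨ha, ha'⟩ ⟨hb, hb'⟩
    refine ⟨fun v hv => Submodule.add_mem _ (ha v hv) (hb v hv), ?_⟩
    change (a : Module.End E V) P.e + (b : Module.End E V) P.e = 0
    rw [ha', hb', add_zero]
  smul_mem' := by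
    rintro c a ⟨ha, ha'⟩
    refine ⟨fun v hv => ?_, ?_⟩
    · change c • (a : Module.End E V) v ∈ P.VH
      rw [← algebraMap_smul E c]
      exact Submodule.smul_mem _ _ (ha v hv)
    · change c • (a : Module.End E V) P.e = 0
      rw [ha', smul_zero]
  lie_mem' := by
    rintro a b ⟨ha, ha'⟩ ⟨hb, hb'⟩
    refine ⟨fun v hv => ?_, ?_⟩
    · exact Submodule.sub_mem _ (ha _ (hb v hv)) (hb _ (ha v hv))
    · change (a : Module.End E V) ((b : Module.End E V) P.e)
        - (b : Module.End E V) ((a : Module.End E V) P.e) = 0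
      rw [ha', hb', map_zero, map_zero, sub_zero]

/-- The adjoint action `Ad(g) x = g x g⁻¹` of `G` on `𝔤`. -/
def Ad (g : P.G) : P.𝔤 →ₗ[F] P.𝔤 where
  toFun x := ⟨((g : V ≃ₗ[E] V) : V →ₗ[E] V) * (x : Module.End E V) *
      (((g⁻¹ : P.G) : V ≃ₗ[E] V) : V →ₗ[E] V), by
    intro v w
    have hv : ∀ u : V, (g : V ≃ₗ[E] V) (((g⁻¹ : P.G) : V ≃ₗ[E] V) u) = u := by
      intro u
      rw [← LinearEquiv.mul_apply, ← Subgroup.coe_mul, mul_inv_cancel]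
      rfl
    have h := x.2 (((g⁻¹ : P.G) : V ≃ₗ[E] V) v) (((g⁻¹ : P.G) : V ≃ₗ[E] V) w)
    rw [← g.2 _ (((g⁻¹ : P.G) : V ≃ₗ[E] V) w), ← g.2 (((g⁻¹ : P.G) : V ≃ₗ[E] V) v), hv, hv] at h
    exact h⟩
  map_add' x y := by
    apply Subtype.ext
    change _ * ((x : Module.End E V) + (y : Module.End E V)) * _ = _
    rw [mul_add, add_mul]
    rfl
  map_smul' c x := by
    apply Subtype.ext
    change _ * (c • (x : Module.End E V)) * _ = _
    rw [mul_smul_comm, smul_mul_assoc]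
    rfl

theorem Ad_one (x : P.𝔤) : P.Ad 1 x = x := rfl

theorem Ad_mul (g h : P.G) (x : P.𝔤) : P.Ad (g * h) x = P.Ad g (P.Ad h x) := by
  apply Subtype.ext
  ext v
  change _ = (g : V ≃ₗ[E] V) ((h : V ≃ₗ[E] V) ((x : Module.End E V)
    (((h⁻¹ : P.G) : V ≃ₗ[E] V) (((g⁻¹ : P.G) : V ≃ₗ[E] V) v))))
  rw [← LinearEquiv.mul_apply ((h⁻¹ : P.G) : V ≃ₗ[E] V), ← Subgroup.coe_mul, ← mul_inv_rev]
  rfl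

/-- The coadjoint action of `G` on `𝔤^∧`: `⟨x, g • ξ⟩ = ⟨Ad(g⁻¹) x, ξ⟩`. -/
instance coadjointAction : MulAction P.G (ImaginaryDual F P.𝔤) where
  smul g ξ := ξ.comap (P.Ad g⁻¹)
  one_smul ξ := by
    apply ImaginaryDual.ext_pairing
    intro x
    change ImaginaryDual.pairing (P.Ad 1⁻¹ x) ξ = _
    rw [inv_one, Ad_one]
  mul_smul g h ξ := by
    apply ImaginaryDual.ext_pairing
    intro x
    change ImaginaryDual.pairing (P.Ad (g * h)⁻¹ x) ξ
      = ImaginaryDual.pairing (P.Ad h⁻¹ (P.Ad g⁻¹ x)) ξ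
    rw [mul_inv_rev, Ad_mul]

theorem pairing_smul (g : P.G) (ξ : ImaginaryDual F P.𝔤) (x : P.𝔤) :
    ImaginaryDual.pairing x (g • ξ) = ImaginaryDual.pairing (P.Ad g⁻¹ x) ξ := rfl

/-- The restriction `τ_H ∈ 𝔥^∧` of `τ ∈ 𝔤^∧`. -/
def restr (τ : ImaginaryDual F P.𝔤) : ImaginaryDual F P.𝔥 :=
  τ.comap (P.𝔥.toSubmodule.subtype)

/-- `τ ∈ 𝔤^∧` is stable (with respect to `H`) if its stabilizer in `H` is finite and its `H`-orbit
is Zariski closed. -/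
def IsStable (τ : ImaginaryDual F P.𝔤) : Prop :=
  Finite (MulAction.stabilizer P.H τ) ∧ ImaginaryDual.IsZariskiClosed (MulAction.orbit P.H τ)

/-- The center `𝔷` of `𝔤`, as a subspace of `𝔤_τ`. -/
def centerIn (τ : ImaginaryDual F P.𝔤) : Submodule F τ.centralizer :=
  (LieAlgebra.center F P.𝔤).toSubmodule.submoduleOf τ.centralizer

theorem center_le_centralizer (τ : ImaginaryDual F P.𝔤) :
    (LieAlgebra.center F P.𝔤).toSubmodule ≤ τ.centralizer := by
  intro x hx
  rw [ImaginaryDual.mem_centralizer_iff]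
  intro y
  have h : ⁅y, x⁆ = 0 := (LieModule.mem_maxTrivSubmodule F P.𝔤 P.𝔤 x).1 hx y
  rw [← lie_skew, h, neg_zero]
  exact map_zero _

/-- The `F`-bilinear form `𝔤_τ × 𝔥_{τ_H} → F`, `(x, y) ↦ ⟨[z, [x, y]], τ⟩`, before passing to the
quotient by `𝔷`, with `τ` regarded as an `F`-linear form on `𝔤`. -/
noncomputable def stabilityForm₀ (τ : ImaginaryDual F P.𝔤) (z : P.𝔥) :
    τ.centralizer →ₗ[F] (P.restr τ).centralizer →ₗ[F] F :=
  LinearMap.mk₂ F (fun x y => τ.toDual ⁅(z : P.𝔤), ⁅(x : P.𝔤), ((y : P.𝔥) : P.𝔤)⁆⁆)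
    (fun x₁ x₂ y => by simp)
    (fun c x y => by simp)
    (fun x y₁ y₂ => by simp)
    (fun c x y => by simp)

/-- The `F`-bilinear form `𝔤_τ / 𝔷 × 𝔥_{τ_H} → F`, `(x, y) ↦ ⟨[z, [x, y]], τ⟩`, with `τ` regarded as
an `F`-linear form on `𝔤`. -/
noncomputable def stabilityForm (τ : ImaginaryDual F P.𝔤) (z : P.𝔥) :
    (τ.centralizer ⧸ P.centerIn τ) →ₗ[F] (P.restr τ).centralizer →ₗ[F] F :=
  (P.centerIn τ).liftQ (P.stabilityForm₀ τ z) (by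
    intro x hx
    have hx' : (x : P.𝔤) ∈ LieAlgebra.center F P.𝔤 := hx
    rw [LinearMap.mem_ker]
    ext y
    have h : ⁅((y : P.𝔥) : P.𝔤), (x : P.𝔤)⁆ = 0 :=
      (LieModule.mem_maxTrivSubmodule F P.𝔤 P.𝔤 _).1 hx' _
    have h' : ⁅(x : P.𝔤), ((y : P.𝔥) : P.𝔤)⁆ = 0 := by rw [← lie_skew, h, neg_zero]
    simp [stabilityForm₀, h'])

/-- The relation of the `F`-valued form with the canonical `iℝ`-valued pairing. For `F = ℝ` the two
forms differ by the factor `i`. -/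
theorem pairing_eq_stabilityForm (τ : ImaginaryDual F P.𝔤) (z : P.𝔥) (x : τ.centralizer)
    (y : (P.restr τ).centralizer) :
    ImaginaryDual.pairing ⁅(z : P.𝔤), ⁅(x : P.𝔤), ((y : P.𝔥) : P.𝔤)⁆⁆ τ
      = Complex.I * ((RCLike.re (P.stabilityForm τ z (Submodule.Quotient.mk x) y) : ℝ) : ℂ) :=
  ImaginaryDual.pairing_eq _ _

end UnitaryGGPPair

/-!
Write `E = F ⊕ F δ` with `δ ^ 2 = d ∈ Fˣ` and `ι δ = -δ`. Since the trace form is nondegenerate on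
skew-hermitian operators, every `τ` is `y ↦ tr_F (δ S y)` for a unique hermitian operator `S` on
`V` (`HermitianSpace.exists_represents`), and then `τ_H` is represented by the compression `S_H` of
`S` to `V_H` (`UnitaryGGPPair.represents_compress`). Both conditions of the theorem turn out to be
equivalent to a third one: `e` is a cyclic vector of `S`, that is, `E[S] e = V`.

*Regularity.* The centralizer of `τ` is the skew-hermitian part of the commutant of `S`, and the
commutant is the sum of this part and `δ` times it. For every hermitian `S` there is a vector `v`
such that evaluation at `v` maps the commutant onto `V`; so the centralizer has dimension at least
`dim V / 2`, with equality if and only if `S` has some cyclic vector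
(`HermitianSpace.Represents.isRegular_iff`).

*The bilinear form.* A nonzero central element `z` of `𝔥` is a scalar `c δ` on `V_H`, and a
computation with rank one operators gives `ℓ([z, [x, y]]) = 2 c d ⟨e, e⟩⁻¹ tr ⟨y S e, x e⟩`
(`UnitaryGGPPair.toDual_lie_lie`). When `S` and `S_H` have cyclic vectors, `x` runs through `δ F[S]`
and `y` through `δ F[S_H]`. Let `u` be the component of `S e` in `V_H`. The projections to `V_H` of
the vectors of `F[S] e` are the vectors of `F[S_H] u`, so the form becomes the pairing of
`F[S_H] u` with itself. It is nondegenerate on `𝔤_τ / 𝔷 × 𝔥_{τ_H}` if and only if `u` is a cyclic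
vector of `S_H`, which is the same as `e` being a cyclic vector of `S`
(`UnitaryGGPPair.isCyclicVector_iff`).

*Cyclic implies stable.* An element of `H` fixing `τ` commutes with `S` and fixes the cyclic vector
`e`, hence is trivial. The moments `⟨e, Sⁿ e⟩` are polynomial functions of `τ`, invariant under `H`.
If `S'` has the same moments, then `p(S') e ↦ p(S) e` is an isometry of `V` which fixes `e` and
conjugates `S'` to `S`; so the orbit is cut out by the moments
(`UnitaryGGPPair.mem_orbit_of_traceForm_eq`).

*Stable implies cyclic.* Let `W = E[S] e ≠ V`. If the form is nondegenerate on `W`, then the scalars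
of norm one on the orthogonal complement of `W` give an infinite stabilizer
(`UnitaryGGPPair.infinite_stabilizer`). Otherwise the radical of `W` is a nonzero isotropic
`S`-stable submodule `R` orthogonal to `e`. A one-parameter subgroup of `H` acting by `t` on `R`
contracts `τ`, as `t → 0`, to an element fixed by this subgroup. If the orbit is closed, it contains
the limit, and the stabilizer is infinite (`UnitaryGGPPair.not_isStable_of_isotropic`).
-/

set_option linter.unusedSectionVars false

/-! ### Hermitian spaces over a quadratic étale algebra -/

/-- A nondegenerate hermitian space over a quadratic étale algebra `E = F ⊕ F δ`, where
`δ ^ 2 = d ∈ Fˣ` and `ι δ = -δ`. The generator `δ` is part of the data: multiplication by `δ`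
exchanges hermitian and skew-hermitian operators. -/
structure HermitianSpace (F E V : Type*) [Field F] [CommRing E] [Algebra F E]
    [AddCommGroup V] [Module E V] where
  ι : E ≃ₐ[F] E
  form : V →ₛₗ[(ι : E →+* E)] V →ₗ[E] E
  hermitian : ∀ v w, ι (form v w) = form w v
  separating : ∀ v, (∀ w, form v w = 0) → v = 0
  δ : E
  ι_δ : ι δ = -δ
  d : F
  d_ne_zero : d ≠ 0
  δ_mul_δ : δ * δ = algebraMap F E d
  exists_repr : ∀ x : E, ∃ a b : F, x = algebraMap F E a + algebraMap F E b * δ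

namespace HermitianSpace

section Scalars

variable {F E V : Type*} [Field F] [CommRing E] [Algebra F E]
  [AddCommGroup V] [Module E V] (𝓗 : HermitianSpace F E V)

theorem ι_ι (x : E) : 𝓗.ι (𝓗.ι x) = x := by
  obtain ⟨a, b, rfl⟩ := 𝓗.exists_repr x
  simp [𝓗.ι_δ]

/-- The inverse of `δ`. -/
noncomputable def δinv : E := algebraMap F E 𝓗.d⁻¹ * 𝓗.δ

theorem δ_mul_δinv : 𝓗.δ * 𝓗.δinv = 1 := by
  rw [δinv, mul_left_comm, 𝓗.δ_mul_δ, ← map_mul, inv_mul_cancel₀ 𝓗.d_ne_zero, map_one]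

theorem δinv_mul_δ : 𝓗.δinv * 𝓗.δ = 1 := by rw [mul_comm, δ_mul_δinv]

theorem ι_δinv : 𝓗.ι 𝓗.δinv = -𝓗.δinv := by simp [δinv, 𝓗.ι_δ]

variable {𝓗} in
theorem δ_mul_eq_zero {x : E} (h : 𝓗.δ * x = 0) : x = 0 := by
  have := congrArg (𝓗.δinv * ·) h
  simpa [← mul_assoc, δinv_mul_δ] using this

variable {𝓗} in
theorem δ_smul_eq_zero {v : V} (h : 𝓗.δ • v = 0) : v = 0 := by
  have := congrArg (𝓗.δinv • ·) h
  simpa [smul_smul, δinv_mul_δ] using this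

variable [CharZero F]

variable (F) in
include F in
theorem two_smul_eq_zero {M : Type*} [AddCommGroup M] [Module E M] {x : M} (h : (2 : E) • x = 0) :
    x = 0 := by
  have h2 : algebraMap F E 2⁻¹ * 2 = 1 := by
    rw [← map_ofNat (algebraMap F E) 2, ← map_mul, inv_mul_cancel₀ two_ne_zero, map_one]
  have := congrArg (algebraMap F E 2⁻¹ • ·) h
  simpa only [smul_smul, h2, one_smul, smul_zero] using this

theorem exists_of_ι_eq {x : E} (h : 𝓗.ι x = x) : ∃ a : F, x = algebraMap F E a := by
  obtain ⟨a, b, rfl⟩ := 𝓗.exists_repr x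
  refine ⟨a, ?_⟩
  have h1 : (2 : E) • (algebraMap F E b * 𝓗.δ) = 0 := by
    simp only [map_add, map_mul, AlgEquiv.commutes, 𝓗.ι_δ] at h
    simp only [smul_eq_mul]
    linear_combination -h
  rw [two_smul_eq_zero F h1, add_zero]

theorem exists_of_ι_eq_neg {x : E} (h : 𝓗.ι x = -x) : ∃ a : F, x = algebraMap F E a * 𝓗.δ := by
  obtain ⟨a, b, rfl⟩ := 𝓗.exists_repr x
  refine ⟨b, ?_⟩
  have h1 : (2 : E) • (algebraMap F E a) = 0 := by
    simp only [map_add, map_mul, AlgEquiv.commutes, 𝓗.ι_δ] at h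
    simp only [smul_eq_mul]
    linear_combination h
  rw [two_smul_eq_zero F h1, zero_add]

variable [Algebra.IsQuadraticExtension F E]

theorem trace_ι (x : E) : Algebra.trace F E (𝓗.ι x) = Algebra.trace F E x :=
  Algebra.trace_eq_of_algEquiv 𝓗.ι x

theorem trace_eq_zero_of_ι_eq_neg {x : E} (h : 𝓗.ι x = -x) : Algebra.trace F E x = 0 := by
  have := 𝓗.trace_ι x
  rw [h, map_neg] at this
  exact self_eq_neg.1 this.symm

theorem trace_algebraMap' (a : F) : Algebra.trace F E (algebraMap F E a) = 2 * a := by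
  rw [Algebra.trace_algebraMap, Algebra.IsQuadraticExtension.finrank_eq_two]
  simp [two_mul, two_smul]

theorem eq_zero_of_trace_eq_zero {x : E} (h : 𝓗.ι x = x) (h' : Algebra.trace F E x = 0) :
    x = 0 := by
  obtain ⟨a, rfl⟩ := 𝓗.exists_of_ι_eq h
  rw [trace_algebraMap'] at h'
  simp_all

include 𝓗 in
/-- The trace form of `E / F` is nondegenerate. -/
theorem eq_zero_of_trace_mul_eq_zero {x : E} (h : ∀ a : E, Algebra.trace F E (a * x) = 0) :
    x = 0 := by
  obtain ⟨a, b, rfl⟩ := 𝓗.exists_repr x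
  have h1 := h 1
  have h2 := h 𝓗.δ
  have h3 : Algebra.trace F E (algebraMap F E b * 𝓗.δ) = 0 :=
    𝓗.trace_eq_zero_of_ι_eq_neg (by simp [𝓗.ι_δ])
  have h4 : Algebra.trace F E (𝓗.δ * algebraMap F E a) = 0 :=
    𝓗.trace_eq_zero_of_ι_eq_neg (by simp [𝓗.ι_δ])
  rw [one_mul, map_add, h3, add_zero, trace_algebraMap'] at h1
  rw [mul_add, map_add, h4, zero_add, mul_left_comm, 𝓗.δ_mul_δ, ← map_mul,
    trace_algebraMap'] at h2
  have := 𝓗.d_ne_zero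
  simp_all

end Scalars

section Operators

variable {F E V : Type*} [Field F] [CommRing E] [Algebra F E] [Algebra.IsQuadraticExtension F E]
  [AddCommGroup V] [Module E V] [Module F V] [IsScalarTower F E V] (𝓗 : HermitianSpace F E V)

theorem form_smul_left (a : E) (v w : V) : 𝓗.form (a • v) w = 𝓗.ι a * 𝓗.form v w := by
  simp

theorem form_smul_right (a : E) (v w : V) : 𝓗.form v (a • w) = a * 𝓗.form v w := by
  simp

theorem form_smul_left_base (a : F) (v w : V) :
    𝓗.form (a • v) w = algebraMap F E a * 𝓗.form v w := by
  rw [← algebraMap_smul E a v, form_smul_left, AlgEquiv.commutes]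

theorem form_smul_right_base (a : F) (v w : V) :
    𝓗.form v (a • w) = algebraMap F E a * 𝓗.form v w := by
  rw [← algebraMap_smul E a w, form_smul_right]

theorem separating_right {v : V} (h : ∀ w, 𝓗.form w v = 0) : v = 0 :=
  𝓗.separating v fun w => by rw [← 𝓗.hermitian, h, map_zero]

/-- The symmetric `F`-bilinear form `tr_{E/F} ⟨v, w⟩`. -/
noncomputable def traceForm : LinearMap.BilinForm F V :=
  LinearMap.mk₂ F (fun v w => Algebra.trace F E (𝓗.form v w))
    (fun v₁ v₂ w => by simp)
    (fun c v w => by rw [form_smul_left_base, ← Algebra.smul_def, map_smul])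
    (fun v w₁ w₂ => by simp)
    (fun c v w => by rw [form_smul_right_base, ← Algebra.smul_def, map_smul])

theorem traceForm_apply (v w : V) : 𝓗.traceForm v w = Algebra.trace F E (𝓗.form v w) := rfl

variable [CharZero F]

theorem traceForm_comm (v w : V) : 𝓗.traceForm v w = 𝓗.traceForm w v := by
  rw [traceForm_apply, traceForm_apply, ← 𝓗.hermitian v w, 𝓗.trace_ι]

theorem traceForm_isSymm : 𝓗.traceForm.IsSymm := ⟨fun v w => 𝓗.traceForm_comm v w⟩

theorem eq_zero_of_traceForm {v : V} (h : ∀ w, 𝓗.traceForm v w = 0) : v = 0 :=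
  𝓗.separating v fun w => 𝓗.eq_zero_of_trace_mul_eq_zero fun a => by
    rw [← form_smul_right]; exact h _

theorem traceForm_nondegenerate : 𝓗.traceForm.Nondegenerate :=
  ⟨fun _ h => 𝓗.eq_zero_of_traceForm h, fun v h => 𝓗.eq_zero_of_traceForm fun w => by
    rw [traceForm_comm]; exact h w⟩

/-- `a` is hermitian, i.e. self-adjoint. -/
def IsHerm (a : Module.End E V) : Prop := ∀ v w, 𝓗.form (a v) w = 𝓗.form v (a w)

/-- `a` is skew-hermitian, i.e. in the Lie algebra of the unitary group. -/
def IsSkew (a : Module.End E V) : Prop := ∀ v w, 𝓗.form (a v) w + 𝓗.form v (a w) = 0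

variable {𝓗} in
theorem IsHerm.δ_smul {a : Module.End E V} (h : 𝓗.IsHerm a) : 𝓗.IsSkew (𝓗.δ • a) := by
  intro v w
  simp only [LinearMap.smul_apply, form_smul_left, form_smul_right, 𝓗.ι_δ, h v w]
  ring

variable {𝓗} in
theorem IsSkew.δ_smul {a : Module.End E V} (h : 𝓗.IsSkew a) : 𝓗.IsHerm (𝓗.δ • a) := by
  intro v w
  simp only [LinearMap.smul_apply, form_smul_left, form_smul_right, 𝓗.ι_δ]
  linear_combination (-𝓗.δ) * h v w

variable {𝓗} in
theorem IsSkew.δinv_smul {a : Module.End E V} (h : 𝓗.IsSkew a) : 𝓗.IsHerm (𝓗.δinv • a) := by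
  intro v w
  simp only [LinearMap.smul_apply, form_smul_left, form_smul_right, 𝓗.ι_δinv]
  linear_combination (-𝓗.δinv) * h v w

theorem δ_smul_δinv_smul {M : Type*} [AddCommGroup M] [Module E M] (a : M) :
    𝓗.δ • 𝓗.δinv • a = a := by
  rw [smul_smul, δ_mul_δinv, one_smul]

theorem δinv_smul_δ_smul {M : Type*} [AddCommGroup M] [Module E M] (a : M) :
    𝓗.δinv • 𝓗.δ • a = a := by
  rw [smul_smul, δinv_mul_δ, one_smul]

variable {𝓗} in
theorem IsHerm.ι_form {a : Module.End E V} (h : 𝓗.IsHerm a) (v : V) :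
    𝓗.ι (𝓗.form v (a v)) = 𝓗.form v (a v) := by
  rw [𝓗.hermitian, h]

theorem isHerm_one : 𝓗.IsHerm 1 := fun _ _ => rfl

variable {𝓗} in
theorem IsHerm.add {a b : Module.End E V} (ha : 𝓗.IsHerm a) (hb : 𝓗.IsHerm b) :
    𝓗.IsHerm (a + b) := fun v w => by
  simp only [LinearMap.add_apply, map_add, ha v w, hb v w]

variable {𝓗} in
theorem IsHerm.smul {a : Module.End E V} (ha : 𝓗.IsHerm a) (c : F) :
    𝓗.IsHerm (c • a) := fun v w => by
  simp only [LinearMap.smul_apply, form_smul_left_base, form_smul_right_base, ha v w]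

variable {𝓗} in
theorem IsHerm.mul {a b : Module.End E V} (ha : 𝓗.IsHerm a) (hb : 𝓗.IsHerm b)
    (h : Commute a b) : 𝓗.IsHerm (a * b) := fun v w => by
  rw [Module.End.mul_apply, ha, hb, ← Module.End.mul_apply, h.eq]

variable {𝓗} in
theorem IsHerm.pow {a : Module.End E V} (ha : 𝓗.IsHerm a) (n : ℕ) : 𝓗.IsHerm (a ^ n) := by
  induction n with
  | zero => exact 𝓗.isHerm_one
  | succ n ih => rw [pow_succ]; exact ih.mul ha (Commute.pow_self a n)

variable {𝓗} in
theorem IsHerm.polynomial {a : Module.End E V} (ha : 𝓗.IsHerm a) (p : Polynomial F) :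
    𝓗.IsHerm (Polynomial.aeval a p) := by
  induction p using Polynomial.induction_on' with
  | add p q hp hq => rw [map_add]; exact hp.add hq
  | monomial n c => rw [Polynomial.aeval_monomial, ← Algebra.smul_def]; exact (ha.pow n).smul c

/-- A hermitian operator with vanishing quadratic form is zero, by polarization: the trace form is
symmetric. -/
theorem IsHerm.eq_zero {a : Module.End E V} (h : 𝓗.IsHerm a) (h0 : ∀ v, 𝓗.form v (a v) = 0) :
    a = 0 := by
  ext v
  refine 𝓗.eq_zero_of_traceForm fun w => ?_
  have h1 := h0 (v + w)
  have h2 := 𝓗.traceForm_comm w (a v)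
  simp only [map_add, LinearMap.add_apply, h0, zero_add, add_zero, ← h v w] at h1
  have h3 := congrArg (Algebra.trace F E) h1
  rw [map_add, map_zero] at h3
  change 𝓗.traceForm _ _ + 𝓗.traceForm _ _ = 0 at h3
  rw [h2] at h3
  exact self_eq_neg.1 (eq_neg_of_add_eq_zero_left h3)

/-- The rank one operator `x ↦ ⟨w, x⟩ u`. -/
def rankOne (u w : V) : Module.End E V := (𝓗.form w).smulRight u

theorem rankOne_apply (u w x : V) : 𝓗.rankOne u w x = 𝓗.form w x • u := rfl

theorem isSkew_rankOne_sub (u w : V) : 𝓗.IsSkew (𝓗.rankOne u w - 𝓗.rankOne w u) := by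
  intro x y
  simp only [LinearMap.sub_apply, rankOne_apply, map_sub, form_smul_left, form_smul_right,
    𝓗.hermitian]
  ring

variable [Module.Finite F V]

variable (F) in
/-- The trace of an `E`-linear operator, regarded as an `F`-linear one. -/
noncomputable def traceF : Module.End E V →ₗ[F] F where
  toFun a := LinearMap.trace F V (a.restrictScalars F)
  map_add' a b := by rw [LinearMap.restrictScalars_add, map_add]
  map_smul' c a := by
    rw [show (c • a).restrictScalars F = c • a.restrictScalars F from rfl, map_smul]; rfl

theorem traceF_mul_comm (a b : Module.End E V) : traceF F (a * b) = traceF F (b * a) :=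
  LinearMap.trace_mul_comm F (a.restrictScalars F) (b.restrictScalars F)

theorem traceF_rankOne (u w : V) : traceF F (𝓗.rankOne u w) = 𝓗.traceForm w u := by
  have h := LinearMap.trace_comp_comm' (R := F) ((𝓗.form w).restrictScalars F)
    ((LinearMap.toSpanSingleton E V u).restrictScalars F)
  refine h.trans ?_
  rw [traceForm_apply, Algebra.trace_apply]
  congr 1
  ext
  simp [mul_comm]

theorem mul_rankOne (a : Module.End E V) (u w : V) : a * 𝓗.rankOne u w = 𝓗.rankOne (a u) w := by
  ext x
  simp [rankOne_apply]

/-- The form `tr (a b)` is nondegenerate on skew-hermitian operators: test against the operators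
`u⟨w, ·⟩ - w⟨u, ·⟩`. -/
theorem IsSkew.eq_zero_of_traceF {a : Module.End E V} (ha : 𝓗.IsSkew a)
    (h : ∀ b, 𝓗.IsSkew b → traceF F (a * b) = 0) : a = 0 := by
  ext u
  refine 𝓗.eq_zero_of_traceForm fun w => ?_
  have h1 := h _ (𝓗.isSkew_rankOne_sub u w)
  rw [mul_sub, map_sub, mul_rankOne, mul_rankOne, traceF_rankOne, traceF_rankOne] at h1
  have h2 := congrArg (Algebra.trace F E) (ha u w)
  rw [map_add, map_zero] at h2
  change 𝓗.traceForm _ _ + 𝓗.traceForm _ _ = 0 at h2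
  rw [𝓗.traceForm_comm w] at h1
  have h3 : 2 * 𝓗.traceForm (a u) w = 0 := by linear_combination h1 + h2
  simpa using h3

/-- The adjoint with respect to the trace form is `E`-linear and adjoint for the hermitian form. -/
theorem exists_adjoint (a : Module.End E V) :
    ∃ b : Module.End E V, ∀ v w, 𝓗.form (b v) w = 𝓗.form v (a w) := by
  set B := 𝓗.traceForm with hB
  let b := B.leftAdjointOfNondegenerate 𝓗.traceForm_nondegenerate (a.restrictScalars F)
  have hb : ∀ v w, B (b v) w = B v (a w) :=
    B.isAdjointPairLeftAdjointOfNondegenerate 𝓗.traceForm_nondegenerate (a.restrictScalars F)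
  have key : ∀ v w, 𝓗.form (b v) w = 𝓗.form v (a w) := by
    intro v w
    rw [← sub_eq_zero]
    refine 𝓗.eq_zero_of_trace_mul_eq_zero fun c => ?_
    rw [mul_sub, ← form_smul_right, ← form_smul_right, ← map_smul, map_sub, sub_eq_zero]
    exact hb v (c • w)
  refine ⟨{ toFun := b, map_add' := map_add b, map_smul' := fun c v => ?_ }, key⟩
  rw [← sub_eq_zero]
  refine 𝓗.separating _ fun w => ?_
  rw [map_sub, LinearMap.sub_apply, key, RingHom.id_apply, form_smul_left, form_smul_left, key,
    sub_self]

/-- The adjoint of an `E`-linear operator. -/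
noncomputable def adjoint (a : Module.End E V) : Module.End E V := (𝓗.exists_adjoint a).choose

theorem form_adjoint_left (a : Module.End E V) (v w : V) :
    𝓗.form (𝓗.adjoint a v) w = 𝓗.form v (a w) := (𝓗.exists_adjoint a).choose_spec v w

theorem form_adjoint_right (a : Module.End E V) (v w : V) :
    𝓗.form v (𝓗.adjoint a w) = 𝓗.form (a v) w := by
  rw [← 𝓗.hermitian, form_adjoint_left, 𝓗.hermitian]

theorem eq_of_form {a b : Module.End E V} (h : ∀ v w, 𝓗.form (a v) w = 𝓗.form (b v) w) :
    a = b := by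
  ext v
  rw [← sub_eq_zero]
  refine 𝓗.separating _ fun w => ?_
  rw [map_sub, LinearMap.sub_apply, h, sub_self]

theorem adjoint_mul (a b : Module.End E V) : 𝓗.adjoint (a * b) = 𝓗.adjoint b * 𝓗.adjoint a :=
  𝓗.eq_of_form fun v w => by simp [form_adjoint_left]

theorem isHerm_iff_adjoint {a : Module.End E V} : 𝓗.IsHerm a ↔ 𝓗.adjoint a = a :=
  ⟨fun h => 𝓗.eq_of_form fun v w => by rw [form_adjoint_left, h],
    fun h v w => by rw [← form_adjoint_left, h]⟩

end Operators

end HermitianSpace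

namespace HermitianSpace

/-! ### Cyclic vectors -/

section Cyclic

open Polynomial

variable {F E V : Type*} [Field F] [CharZero F] [CommRing E] [Algebra F E]
  [Algebra.IsQuadraticExtension F E] [AddCommGroup V] [Module E V] [Module F V]
  [IsScalarTower F E V] (𝓗 : HermitianSpace F E V)

/-- Evaluation of polynomials in `S` at the vector `v`, as an `E`-linear map. Its range is the
`S`-stable submodule generated by `v`. -/
noncomputable def evalAt (S : Module.End E V) (v : V) : E[X] →ₗ[E] V :=
  (LinearMap.applyₗ v) ∘ₗ (Polynomial.aeval S).toLinearMap

theorem evalAt_apply (S : Module.End E V) (v : V) (p : E[X]) :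
    evalAt S v p = aeval S p v := rfl

/-- `v` is a cyclic vector of `S`: the module `V` is generated by `v` over `E[S]`. -/
def IsCyclicVector (S : Module.End E V) (v : V) : Prop := ∀ w, ∃ p : E[X], aeval S p v = w

theorem commute_aeval {S x : Module.End E V} (h : Commute S x) (p : E[X]) :
    Commute (aeval S p) x := by
  induction p using Polynomial.induction_on' with
  | add p q hp hq => rw [map_add]; exact hp.add_left hq
  | monomial n c =>
    rw [aeval_monomial]
    exact Commute.mul_left (Algebra.commutes c x) (h.pow_left n)

/-- An operator in the commutant of `S` is determined by its value at a cyclic vector. -/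
theorem IsCyclicVector.eq_zero {S x : Module.End E V} {v : V} (hv : IsCyclicVector S v)
    (h : Commute S x) (h0 : x v = 0) : x = 0 := by
  ext w
  obtain ⟨p, rfl⟩ := hv w
  rw [← Module.End.mul_apply, ← (commute_aeval h p).eq, Module.End.mul_apply, h0, map_zero,
    LinearMap.zero_apply]

theorem aeval_map_algebraMap' (S : Module.End E V) (p : F[X]) :
    aeval S (p.map (algebraMap F E)) = aeval S p := by
  induction p using Polynomial.induction_on' with
  | add p q hp hq => rw [Polynomial.map_add, map_add, map_add, hp, hq]
  | monomial n c =>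
    rw [Polynomial.map_monomial, aeval_monomial, aeval_monomial, ← Algebra.smul_def,
      ← Algebra.smul_def, algebraMap_smul]

/-- The decomposition `E[X] = F[X] ⊕ δ F[X]`, evaluated at an operator. -/
theorem exists_aeval_eq (S : Module.End E V) (p : E[X]) :
    ∃ p₁ p₂ : F[X], aeval S p = aeval S p₁ + 𝓗.δ • aeval S p₂ := by
  induction p using Polynomial.induction_on' with
  | add p q hp hq =>
    obtain ⟨p₁, p₂, hp⟩ := hp
    obtain ⟨q₁, q₂, hq⟩ := hq
    refine ⟨p₁ + q₁, p₂ + q₂, ?_⟩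
    rw [map_add, map_add, map_add, hp, hq, smul_add]
    abel
  | monomial n c =>
    obtain ⟨a, b, rfl⟩ := 𝓗.exists_repr c
    refine ⟨monomial n a, monomial n b, ?_⟩
    simp only [aeval_monomial, ← Algebra.smul_def, add_smul, mul_comm _ 𝓗.δ, mul_smul,
      algebraMap_smul]

variable [Module.Finite F V]

theorem finite_end : Module.Finite F (Module.End E V) :=
  Module.Finite.of_injective (LinearMap.restrictScalarsₗ F E V V F)
    (LinearMap.restrictScalars_injective F)

/-- Finitely many nonzero hermitian operators have a common vector on which none of their quadratic
forms vanishes. -/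
theorem exists_forall_form_ne_zero (s : Finset (Module.End E V))
    (hs : ∀ a ∈ s, 𝓗.IsHerm a ∧ a ≠ 0) : ∃ v, ∀ a ∈ s, 𝓗.traceForm v (a v) ≠ 0 := by
  classical
  induction s using Finset.induction_on with
  | empty => exact ⟨0, by simp⟩
  | insert a s ha ih =>
    obtain ⟨v, hv⟩ := ih fun b hb => hs b (Finset.mem_insert_of_mem hb)
    obtain ⟨w, hw⟩ : ∃ w, 𝓗.traceForm w (a w) ≠ 0 := by
      by_contra! h
      obtain ⟨h1, h2⟩ := hs a (Finset.mem_insert_self a s)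
      exact h2 (IsHerm.eq_zero 𝓗 h1 fun v => 𝓗.eq_zero_of_trace_eq_zero (h1.ι_form v) (h v))
    -- The quadratic form of `b` along the line `v + t w` is a polynomial in `t`.
    let P : Module.End E V → F[X] := fun b => C (𝓗.traceForm v (b v)) +
      C (𝓗.traceForm v (b w) + 𝓗.traceForm w (b v)) * X + C (𝓗.traceForm w (b w)) * X ^ 2
    have hP : ∀ b t, (P b).eval t = 𝓗.traceForm (v + t • w) (b (v + t • w)) := by
      intro b t
      have : b (t • w) = t • b w := LinearMap.map_smul_of_tower b t w
      simp only [P, eval_add, eval_mul, eval_C, eval_X, eval_pow, map_add, LinearMap.add_apply,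
        this, map_smul, LinearMap.smul_apply, smul_eq_mul]
      ring
    have hne : ∏ b ∈ insert a s, P b ≠ 0 := by
      rw [Finset.prod_ne_zero_iff]
      intro b hb h0
      rcases Finset.mem_insert.1 hb with rfl | hb
      · apply hw
        have := congrArg (fun p => p.coeff 2) h0
        simpa [P, coeff_X, coeff_C] using this
      · apply hv b hb
        have := congrArg (fun p => p.coeff 0) h0
        simpa [P] using this
    obtain ⟨t, ht⟩ : ∃ t, (∏ b ∈ insert a s, P b).eval t ≠ 0 := by
      by_contra! h
      exact hne (Polynomial.funext fun t => by rw [h, eval_zero])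
    refine ⟨v + t • w, fun b hb => ?_⟩
    rw [← hP]
    rw [eval_prod, Finset.prod_ne_zero_iff] at ht
    exact ht b hb

/-- A vector `v` for which the functional `a ↦ tr ⟨v, a v⟩` on `F[S]` vanishes on no nonzero
ideal. It suffices that the functional vanishes on no minimal ideal, and for this that finitely many
quadratic forms do not vanish at `v`. -/
theorem exists_vector_minpoly_dvd {S : Module.End E V} (hS : 𝓗.IsHerm S) :
    ∃ v, ∀ p : F[X], (∀ q : F[X], 𝓗.traceForm v (aeval S (p * q) v) = 0) → aeval S p = 0 := by
  classical
  have := finite_end (F := F) (E := E) (V := V)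
  set m := minpoly F S with hm
  have hm0 : m ≠ 0 := minpoly.ne_zero (Algebra.IsIntegral.isIntegral S)
  have hmS : aeval S m = 0 := minpoly.aeval F S
  -- The ideals generated by the `m / π` are the minimal ideals of `F[X] / m`.
  obtain ⟨v, hv⟩ := 𝓗.exists_forall_form_ne_zero
    ((UniqueFactorizationMonoid.normalizedFactors m).toFinset.image fun π => aeval S (m / π)) (by
      intro a ha
      obtain ⟨π, hπ, rfl⟩ := Finset.mem_image.1 ha
      rw [Multiset.mem_toFinset] at hπ
      refine ⟨hS.polynomial _, fun h0 => ?_⟩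
      obtain ⟨k, hk⟩ := minpoly.dvd F S h0
      have hπi := UniqueFactorizationMonoid.irreducible_of_normalized_factor π hπ
      have hπm := UniqueFactorizationMonoid.dvd_of_mem_normalizedFactors hπ
      have h1 : π * (m / π) = m := EuclideanDomain.mul_div_cancel' hπi.ne_zero hπm
      have h2 : m * 1 = m * (π * k) := by
        conv_lhs => rw [mul_one, ← h1, hk]
        ring
      exact hπi.not_isUnit (.of_mul_eq_one k (mul_left_cancel₀ hm0 h2).symm))
  refine ⟨v, fun p hp => ?_⟩
  suffices h : m ∣ p by
    obtain ⟨k, rfl⟩ := h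
    rw [map_mul, hmS, zero_mul]
  by_contra hmp
  -- Otherwise `p` generates a nonzero ideal of `F[X] / m`, which contains some `m / π`.
  obtain ⟨h, hh⟩ := EuclideanDomain.gcd_dvd_right p m
  have hunit : ¬ IsUnit h := by
    intro hu
    apply hmp
    refine dvd_trans ?_ (EuclideanDomain.gcd_dvd_left p m)
    conv_lhs => rw [hh]
    rw [hu.mul_right_dvd]
  have hh0 : h ≠ 0 := by
    rintro rfl
    exact hm0 (by rw [hh, mul_zero])
  obtain ⟨π₀, hπ₀, hπ₀h⟩ := WfDvdMonoid.exists_irreducible_factor hunit hh0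
  have hhm : h ∣ m := ⟨_, by rw [mul_comm]; exact hh⟩
  obtain ⟨π, hπ, hass⟩ := UniqueFactorizationMonoid.exists_mem_normalizedFactors_of_dvd hm0 hπ₀
    (hπ₀h.trans hhm)
  obtain ⟨k, hk⟩ := hass.symm.dvd.trans hπ₀h
  have hπ0 : π ≠ 0 := (UniqueFactorizationMonoid.irreducible_of_normalized_factor π hπ).ne_zero
  apply hv (aeval S (m / π)) (Finset.mem_image_of_mem _ (Multiset.mem_toFinset.2 hπ))
  have h1 : m / π = p * (EuclideanDomain.gcdA p m * k) + m * (EuclideanDomain.gcdB p m * k) := by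
    rw [← mul_assoc, ← mul_assoc, ← add_mul, ← EuclideanDomain.gcd_eq_gcd_ab]
    have h2 : m = π * (EuclideanDomain.gcd p m * k) := by
      conv_lhs => rw [hh, hk]
      ring
    conv_lhs => rw [h2]
    exact mul_div_cancel_left₀ _ hπ0
  rw [h1, map_add, map_mul (aeval S) m, hmS, zero_mul, add_zero]
  exact hp _

/-- There is a vector `v` such that the form is nondegenerate on `E[S] v` and `p(S) v = 0` only if
`p(S) = 0`. -/
theorem exists_vector_nondegenerate {S : Module.End E V} (hS : 𝓗.IsHerm S) :
    ∃ v, ∀ p : E[X], (∀ q : E[X], 𝓗.form (aeval S q v) (aeval S p v) = 0) → aeval S p = 0 := by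
  obtain ⟨v, hv⟩ := 𝓗.exists_vector_minpoly_dvd hS
  refine ⟨v, fun p hp => ?_⟩
  obtain ⟨p₁, p₂, hp'⟩ := 𝓗.exists_aeval_eq S p
  have hι : ∀ r : F[X], 𝓗.ι (𝓗.form v (aeval S r v)) = 𝓗.form v (aeval S r v) :=
    fun r => (hS.polynomial r).ι_form v
  have key : ∀ q : F[X], 𝓗.form v (aeval S (p₁ * q) v) = 0 ∧
      𝓗.form v (aeval S (p₂ * q) v) = 0 := by
    intro q
    have h1 := hp (q.map (algebraMap F E))
    rw [aeval_map_algebraMap', hS.polynomial q, hp', LinearMap.add_apply, LinearMap.smul_apply,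
      map_add, map_smul, map_add, form_smul_right, ← Module.End.mul_apply, ← Module.End.mul_apply,
      ← map_mul, ← map_mul, mul_comm q, mul_comm q] at h1
    -- Applying `ι` separates the components in `F` and `F δ`.
    have h2 := congrArg 𝓗.ι h1
    rw [map_add, map_mul 𝓗.ι, hι, hι, map_zero, 𝓗.ι_δ] at h2
    have h3 : 𝓗.form v (aeval S (p₁ * q) v) = 0 := by
      have h4 : (2 : E) • 𝓗.form v (aeval S (p₁ * q) v) = 0 := by
        rw [smul_eq_mul]
        linear_combination h1 + h2
      exact two_smul_eq_zero F h4
    rw [h3, zero_add] at h1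
    exact ⟨h3, δ_mul_eq_zero h1⟩
  rw [hp', hv p₁ fun q => by rw [traceForm_apply, (key q).1, map_zero],
    hv p₂ fun q => by rw [traceForm_apply, (key q).2, map_zero], smul_zero, add_zero]

/-- The orthogonal complement of a submodule, for the hermitian form. -/
def orth (W : Submodule E V) : Submodule E V where
  carrier := {v | ∀ w ∈ W, 𝓗.form w v = 0}
  zero_mem' := by intro w _; simp
  add_mem' := by
    intro a b ha hb w hw
    rw [map_add, ha w hw, hb w hw, add_zero]
  smul_mem' := by
    intro c a ha w hw
    rw [map_smul, ha w hw, smul_zero]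

theorem mem_orth {W : Submodule E V} {v : V} : v ∈ 𝓗.orth W ↔ ∀ w ∈ W, 𝓗.form w v = 0 := Iff.rfl

theorem orth_restrictScalars (W : Submodule E V) :
    𝓗.traceForm.orthogonal (W.restrictScalars F) = (𝓗.orth W).restrictScalars F := by
  ext v
  simp only [LinearMap.BilinForm.mem_orthogonal_iff, Submodule.restrictScalars_mem, mem_orth]
  refine ⟨fun h w hw => 𝓗.eq_zero_of_trace_mul_eq_zero fun a => ?_, fun h w hw => ?_⟩
  · have := h (𝓗.ι a • w) (W.smul_mem _ hw)
    rwa [traceForm_apply, form_smul_left, ι_ι] at this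
  · rw [traceForm_apply, h w hw, map_zero]

theorem isCompl_orth {W : Submodule E V} (h : Disjoint W (𝓗.orth W)) : IsCompl W (𝓗.orth W) := by
  have h1 : IsCompl (W.restrictScalars F) (𝓗.traceForm.orthogonal (W.restrictScalars F)) := by
    rw [LinearMap.BilinForm.isCompl_orthogonal_iff_disjoint 𝓗.traceForm_isSymm.isRefl,
      orth_restrictScalars]
    rw [Submodule.disjoint_def] at h ⊢
    exact h
  refine ⟨h, codisjoint_iff_le_sup.2 fun v _ => ?_⟩
  rw [orth_restrictScalars] at h1
  obtain ⟨a, ha, b, hb, rfl⟩ := Submodule.mem_sup.1 (h1.sup_eq_top ▸ Submodule.mem_top : v ∈ _)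
  exact Submodule.add_mem_sup ha hb

/-- The orthogonal complement of a proper submodule is nonzero. -/
theorem orth_ne_bot {W : Submodule E V} (h : W ≠ ⊤) : 𝓗.orth W ≠ ⊥ := by
  intro h0
  have h1 := 𝓗.isCompl_orth (W := W) (by rw [h0]; exact disjoint_bot_right)
  rw [h0] at h1
  exact h (by simpa using h1.sup_eq_top)

/-- For every hermitian `S` there is a vector `v` at which evaluation maps the commutant of `S` onto
`V`; if evaluation at `v` is moreover injective on the commutant, then `v` is cyclic. The vector is
that of `exists_vector_nondegenerate`: then `V = E[S] v ⊕ (E[S] v)ᗮ`, and for any `w` the operator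
`p(S) v ↦ p(S) w`, extended by zero, is well defined and commutes with `S`. -/
theorem exists_surjective_eval {S : Module.End E V} (hS : 𝓗.IsHerm S) :
    ∃ v, (∀ w, ∃ x, Commute S x ∧ x v = w) ∧
      ((∀ x, Commute S x → x v = 0 → x = 0) → IsCyclicVector S v) := by
  obtain ⟨v, hv⟩ := 𝓗.exists_vector_nondegenerate hS
  set W := LinearMap.range (evalAt S v) with hW
  have hSW : ∀ y ∈ W, S y ∈ W := by
    rintro _ ⟨p, rfl⟩
    refine ⟨X * p, ?_⟩
    rw [evalAt_apply, map_mul, aeval_X]; rfl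
  have hSW' : ∀ y ∈ 𝓗.orth W, S y ∈ 𝓗.orth W := fun y hy w hw => by
    rw [← hS, hy _ (hSW w hw)]
  have hdisj : Disjoint W (𝓗.orth W) := by
    rw [Submodule.disjoint_def]
    rintro _ ⟨p, rfl⟩ h
    rw [evalAt_apply, hv p fun q => h _ ⟨q, rfl⟩, LinearMap.zero_apply]
  have hcompl := 𝓗.isCompl_orth hdisj
  have hker : ∀ p : E[X], aeval S p v = 0 → aeval S p = 0 := fun p hp =>
    hv p fun q => by rw [hp, map_zero]
  have main : ∀ w, ∃ x : Module.End E V, Commute S x ∧ x v = w ∧ ∀ y ∈ 𝓗.orth W, x y = 0 := by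
    intro w
    have hle : LinearMap.ker (evalAt S v) ≤ LinearMap.ker (evalAt S w) := by
      intro p hp
      rw [LinearMap.mem_ker, evalAt_apply] at hp ⊢
      rw [hker p hp, LinearMap.zero_apply]
    let x₀ : W →ₗ[E] V := (LinearMap.ker (evalAt S v)).liftQ (evalAt S w) hle ∘ₗ
      (evalAt S v).quotKerEquivRange.symm.toLinearMap
    have hx₀ : ∀ p : E[X], ∀ h : aeval S p v ∈ W, x₀ ⟨aeval S p v, h⟩ = aeval S p w := by
      intro p h
      have : (evalAt S v).quotKerEquivRange.symm ⟨aeval S p v, h⟩ = Submodule.Quotient.mk p := by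
        rw [LinearEquiv.symm_apply_eq]
        rfl
      simp only [x₀, LinearMap.comp_apply, LinearEquiv.coe_coe, this]
      rfl
    let x : Module.End E V := x₀ ∘ₗ W.projectionOnto (𝓗.orth W) hcompl
    have hx1 : ∀ p : E[X], x (aeval S p v) = aeval S p w := by
      intro p
      have h : aeval S p v ∈ W := ⟨p, rfl⟩
      simp only [x, LinearMap.comp_apply]
      rw [Submodule.projectionOnto_apply_left hcompl ⟨_, h⟩, hx₀]
    have hx2 : ∀ y ∈ 𝓗.orth W, x y = 0 := by
      intro y hy
      simp only [x, LinearMap.comp_apply]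
      rw [(Submodule.projectionOnto_apply_eq_zero_iff hcompl).2 hy, map_zero]
    refine ⟨x, ?_, ?_, hx2⟩
    · ext y
      obtain ⟨_, ⟨p, rfl⟩, b, hb, rfl⟩ :=
        Submodule.mem_sup.1 (hcompl.sup_eq_top ▸ Submodule.mem_top : y ∈ _)
      have h1 : S (aeval S p v) = aeval S (X * p : E[X]) v := by rw [map_mul, aeval_X]; rfl
      rw [Module.End.mul_apply, Module.End.mul_apply, map_add, map_add, map_add, map_add,
        hx2 b hb, hx2 _ (hSW' b hb), evalAt_apply, h1, hx1, hx1, map_mul, aeval_X, map_zero]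
      rfl
    · simpa using hx1 (1 : E[X])
  refine ⟨v, fun w => (main w).imp fun x hx => ⟨hx.1, hx.2.1⟩, fun hinj w => ?_⟩
  -- The projection onto `E[S] v` is the identity, because it agrees with it at `v`.
  obtain ⟨x, hx, hxv, hx0⟩ := main v
  have h1 : x - 1 = 0 := hinj _ (hx.sub_right (Commute.one_right S)) (by simp [hxv])
  have h2 : 𝓗.orth W = ⊥ := by
    rw [eq_bot_iff]
    intro y hy
    have := hx0 y hy
    rw [sub_eq_zero.1 h1] at this
    exact this
  have h3 : W = ⊤ := by
    by_contra h
    exact 𝓗.orth_ne_bot h h2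
  have : w ∈ W := h3 ▸ Submodule.mem_top
  exact this

end Cyclic

end HermitianSpace

namespace HermitianSpace

/-! ### The dimension of the commutant of a hermitian operator -/

section Commutant

open Polynomial

variable {F E V : Type*} [Field F] [CharZero F] [CommRing E] [Algebra F E]
  [Algebra.IsQuadraticExtension F E] [AddCommGroup V] [Module E V] [Module F V]
  [IsScalarTower F E V] (𝓗 : HermitianSpace F E V)

/-- The skew-hermitian operators commuting with `S`. -/
def skewCommutant (S : Module.End E V) : Submodule F (Module.End E V) where
  carrier := {x | 𝓗.IsSkew x ∧ Commute S x}
  zero_mem' := ⟨fun v w => by simp, Commute.zero_right S⟩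
  add_mem' := by
    rintro a b ⟨ha, ha'⟩ ⟨hb, hb'⟩
    refine ⟨fun v w => ?_, ha'.add_right hb'⟩
    have h1 := ha v w
    have h2 := hb v w
    simp only [LinearMap.add_apply, map_add]
    linear_combination h1 + h2
  smul_mem' := by
    rintro c a ⟨ha, ha'⟩
    refine ⟨fun v w => ?_, ha'.smul_right c⟩
    rw [LinearMap.smul_apply, LinearMap.smul_apply, form_smul_left_base, form_smul_right_base,
      ← mul_add, ha, mul_zero]

theorem mem_skewCommutant {S x : Module.End E V} :
    x ∈ 𝓗.skewCommutant S ↔ 𝓗.IsSkew x ∧ Commute S x := Iff.rfl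

/-- The commutant of a hermitian operator is closed under adjoints, so its elements split into a
skew-hermitian and a hermitian part, the latter being `δ` times a skew-hermitian operator. -/
theorem exists_skew_add_δ_smul [Module.Finite F V] {S x : Module.End E V} (hS : 𝓗.IsHerm S)
    (hx : Commute S x) : ∃ a ∈ 𝓗.skewCommutant S, ∃ b ∈ 𝓗.skewCommutant S, x = a + 𝓗.δ • b := by
  set y := 𝓗.adjoint x with hy
  have hSy : Commute S y := by
    have h := congrArg 𝓗.adjoint hx.eq
    rw [adjoint_mul, adjoint_mul, 𝓗.isHerm_iff_adjoint.1 hS] at h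
    exact h.symm
  have ha : 𝓗.IsSkew ((2⁻¹ : F) • (x - y)) := by
    intro v w
    simp only [LinearMap.smul_apply, LinearMap.sub_apply, form_smul_left_base,
      form_smul_right_base, map_sub, hy, form_adjoint_left, form_adjoint_right]
    ring
  have hb : 𝓗.IsHerm ((2⁻¹ : F) • (x + y)) := by
    intro v w
    simp only [LinearMap.smul_apply, LinearMap.add_apply, form_smul_left_base,
      form_smul_right_base, map_add, hy, form_adjoint_left, form_adjoint_right]
    ring
  have hb' : 𝓗.IsSkew (𝓗.δinv • (2⁻¹ : F) • (x + y)) := by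
    intro v w
    rw [LinearMap.smul_apply 𝓗.δinv, LinearMap.smul_apply 𝓗.δinv, form_smul_left, form_smul_right,
      𝓗.ι_δinv, hb]
    ring
  refine ⟨_, ⟨ha, (hx.sub_right hSy).smul_right _⟩, _,
    ⟨hb', ((hx.add_right hSy).smul_right _).smul_right _⟩, ?_⟩
  rw [δ_smul_δinv_smul, ← smul_add, sub_add_add_cancel, ← two_smul F, smul_smul,
    inv_mul_cancel₀ two_ne_zero, one_smul]

variable {𝓗} in
theorem IsSkew.eq_zero_of_isHerm {a : Module.End E V} (ha : 𝓗.IsSkew a) (ha' : 𝓗.IsHerm a) :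
    a = 0 := by
  ext v
  refine 𝓗.separating _ fun w => ?_
  have h1 := ha v w
  rw [← ha' v w] at h1
  have h2 : (2 : E) • 𝓗.form (a v) w = 0 := by rw [two_smul]; exact h1
  exact two_smul_eq_zero F h2

/-- The map `(a, b) ↦ (a + δ b) v` on pairs of skew-hermitian operators commuting with `S`. Such
`a + δ b` exhaust the commutant of `S`. -/
def evalPair (S : Module.End E V) (v : V) :
    (𝓗.skewCommutant S × 𝓗.skewCommutant S) →ₗ[F] V where
  toFun x := (x.1 : Module.End E V) v + 𝓗.δ • (x.2 : Module.End E V) v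
  map_add' x y := by
    simp only [Prod.fst_add, Prod.snd_add, Submodule.coe_add, LinearMap.add_apply, smul_add]
    abel
  map_smul' c x := by
    simp only [Prod.smul_fst, Prod.smul_snd, Submodule.coe_smul, LinearMap.smul_apply, smul_add,
      RingHom.id_apply, smul_comm c]

theorem evalPair_injective {S : Module.End E V} {v : V}
    (hinj : ∀ x, Commute S x → x v = 0 → x = 0) :
    Function.Injective (𝓗.evalPair S v) := by
  rw [← LinearMap.ker_eq_bot, LinearMap.ker_eq_bot']
  rintro ⟨⟨a, ha⟩, ⟨b, hb⟩⟩ h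
  have h1 : a + 𝓗.δ • b = 0 := hinj _ (ha.2.add_right (hb.2.smul_right _)) h
  have h2 : a = 0 := ha.1.eq_zero_of_isHerm (by
    have h3 := hb.1.δ_smul
    intro v w
    have h4 := h3 v w
    rw [eq_neg_of_add_eq_zero_left h1]
    simp only [LinearMap.neg_apply, map_neg, h4])
  rw [h2, zero_add] at h1
  have h5 : b = 0 := by
    ext v
    exact δ_smul_eq_zero (𝓗 := 𝓗) (LinearMap.congr_fun h1 v)
  simp [h2, h5]

variable [Module.Finite F V]

theorem evalPair_surjective {S : Module.End E V} (hS : 𝓗.IsHerm S) {v : V}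
    (hv : ∀ w, ∃ x, Commute S x ∧ x v = w) : Function.Surjective (𝓗.evalPair S v) := by
  intro w
  obtain ⟨x, hx, rfl⟩ := hv w
  obtain ⟨a, ha, b, hb, rfl⟩ := 𝓗.exists_skew_add_δ_smul hS hx
  exact ⟨(⟨a, ha⟩, ⟨b, hb⟩), rfl⟩

theorem finrank_le_of_isHerm {S : Module.End E V} (hS : 𝓗.IsHerm S) :
    Module.finrank F V ≤ 2 * Module.finrank F (𝓗.skewCommutant S) := by
  have := finite_end (F := F) (E := E) (V := V)
  obtain ⟨v, hv, -⟩ := 𝓗.exists_surjective_eval hS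
  have := LinearMap.finrank_le_finrank_of_surjective (𝓗.evalPair_surjective hS hv)
  rwa [Module.finrank_prod, ← two_mul] at this

theorem finrank_skewCommutant_le_of_isCyclicVector {S : Module.End E V} {v : V}
    (hv : IsCyclicVector S v) : 2 * Module.finrank F (𝓗.skewCommutant S) ≤ Module.finrank F V := by
  have := LinearMap.finrank_le_finrank_of_injective
    (𝓗.evalPair_injective fun x hx hx0 => hv.eq_zero hx hx0)
  rwa [Module.finrank_prod, ← two_mul] at this

theorem exists_isCyclicVector_of_finrank_le {S : Module.End E V} (hS : 𝓗.IsHerm S)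
    (h : 2 * Module.finrank F (𝓗.skewCommutant S) ≤ Module.finrank F V) :
    ∃ v, IsCyclicVector S v := by
  have := finite_end (F := F) (E := E) (V := V)
  obtain ⟨v, hv, hv'⟩ := 𝓗.exists_surjective_eval hS
  have hsurj := 𝓗.evalPair_surjective hS hv
  have hrank : Module.finrank F (𝓗.skewCommutant S × 𝓗.skewCommutant S) = Module.finrank F V :=
    le_antisymm (by rwa [Module.finrank_prod, ← two_mul])
      (LinearMap.finrank_le_finrank_of_surjective hsurj)
  have hinj := (LinearMap.injective_iff_surjective_of_finrank_eq_finrank hrank).2 hsurj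
  refine ⟨v, hv' fun x hx hx0 => ?_⟩
  obtain ⟨a, ha, b, hb, rfl⟩ := 𝓗.exists_skew_add_δ_smul hS hx
  have h1 : 𝓗.evalPair S v (⟨a, ha⟩, ⟨b, hb⟩) = 0 := hx0
  have h2 := hinj (h1.trans (map_zero _).symm)
  obtain ⟨h3, h4⟩ := Prod.ext_iff.1 h2
  rw [show a = 0 from congrArg Subtype.val h3, show b = 0 from congrArg Subtype.val h4,
    smul_zero, add_zero]

/-- A proper submodule on which the form is nondegenerate has an anisotropic vector in its
orthogonal complement: otherwise the form vanishes on the complement, by polarization. -/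
theorem exists_orthogonal_extension {U : Submodule E V} (hU : U ≠ ⊤)
    (hcompl : IsCompl U (𝓗.orth U)) : ∃ v ∈ 𝓗.orth U, 𝓗.form v v ≠ 0 := by
  by_contra! h
  apply 𝓗.orth_ne_bot hU
  rw [eq_bot_iff]
  intro x hx
  have hiso : ∀ y ∈ 𝓗.orth U, 𝓗.form x y = 0 := by
    intro y hy
    refine 𝓗.eq_zero_of_trace_mul_eq_zero fun a => ?_
    rw [← form_smul_right]
    have hay := (𝓗.orth U).smul_mem a hy
    have h1 := h _ (Submodule.add_mem _ hx hay)
    rw [map_add 𝓗.form, LinearMap.add_apply, map_add, map_add, h _ hx, h _ hay, zero_add,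
      add_zero] at h1
    have h2 := congrArg (Algebra.trace F E) h1
    rw [map_add, map_zero] at h2
    have h3 := 𝓗.traceForm_comm x (a • y)
    rw [traceForm_apply, traceForm_apply] at h3
    rw [← h3] at h2
    exact self_eq_neg.1 (eq_neg_of_add_eq_zero_left h2)
  refine (Submodule.mem_bot E).2 (𝓗.separating x fun w => ?_)
  obtain ⟨u, hu, y, hy, rfl⟩ :=
    Submodule.mem_sup.1 (hcompl.sup_eq_top ▸ Submodule.mem_top : w ∈ _)
  rw [map_add, hiso y hy, add_zero, ← 𝓗.hermitian, hx u hu, map_zero]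

/-- The form is nondegenerate on the span of an orthogonal family of anisotropic vectors. Here
`⟨v i, v i⟩` is invertible even if `E` is not a field, because it is a nonzero element of `F`. -/
theorem isCompl_orth_span {k : ℕ} {v : Fin k → V} (h0 : ∀ i j, i ≠ j → 𝓗.form (v i) (v j) = 0)
    (h1 : ∀ i, 𝓗.form (v i) (v i) ≠ 0) :
    IsCompl (Submodule.span E (Set.range v)) (𝓗.orth (Submodule.span E (Set.range v))) := by
  refine 𝓗.isCompl_orth ?_
  rw [Submodule.disjoint_def]
  intro x hx hx'
  obtain ⟨c, rfl⟩ := (Submodule.mem_span_range_iff_exists_fun E).1 hx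
  refine Finset.sum_eq_zero fun i _ => ?_
  have h2 := hx' (v i) (Submodule.subset_span ⟨i, rfl⟩)
  rw [map_sum, Finset.sum_eq_single i (fun j _ hj => by
    rw [form_smul_right, h0 i j hj.symm, mul_zero]) (by simp), form_smul_right] at h2
  obtain ⟨a, ha⟩ := 𝓗.exists_of_ι_eq (𝓗.hermitian (v i) (v i))
  have ha0 : a ≠ 0 := by
    rintro rfl
    exact h1 i (by rw [ha, map_zero])
  have h3 : c i = 0 := by
    have := congrArg (· * algebraMap F E a⁻¹) h2
    simpa only [ha, mul_assoc, ← map_mul, mul_inv_cancel₀ ha0, map_one, mul_one, zero_mul]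
      using this
  rw [h3, zero_smul]

/-- `V` is spanned by an orthogonal family of anisotropic vectors. -/
theorem exists_orthogonal_span : ∃ (k : ℕ) (v : Fin k → V),
    (∀ i j, i ≠ j → 𝓗.form (v i) (v j) = 0) ∧ (∀ i, 𝓗.form (v i) (v i) ≠ 0) ∧
    Submodule.span E (Set.range v) = ⊤ := by
  by_contra! hcon
  have main : ∀ k : ℕ, ∃ v : Fin k → V,
      (∀ i j, i ≠ j → 𝓗.form (v i) (v j) = 0) ∧ (∀ i, 𝓗.form (v i) (v i) ≠ 0) := by
    intro k
    induction k with
    | zero => exact ⟨Fin.elim0, fun i => i.elim0, fun i => i.elim0⟩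
    | succ k ih =>
      obtain ⟨v, h0, h1⟩ := ih
      obtain ⟨w, hw, hw'⟩ := 𝓗.exists_orthogonal_extension (hcon k v h0 h1)
        (𝓗.isCompl_orth_span h0 h1)
      have hvw : ∀ i, 𝓗.form (v i) w = 0 := fun i => hw _ (Submodule.subset_span ⟨i, rfl⟩)
      have hwv : ∀ i, 𝓗.form w (v i) = 0 := fun i => by rw [← 𝓗.hermitian, hvw, map_zero]
      refine ⟨Fin.cons w v, fun i j => ?_, fun i => ?_⟩
      · refine Fin.cases ?_ (fun i => ?_) i <;> refine Fin.cases ?_ (fun j => ?_) j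
        · intro h; exact absurd rfl h
        · intro _; simpa using hwv j
        · intro _; simpa using hvw i
        · intro h; simpa using h0 i j (fun hij => h (by rw [hij]))
      · refine Fin.cases ?_ (fun i => ?_) i
        · simpa using hw'
        · simpa using h1 i
  obtain ⟨v, h0, h1⟩ := main (Module.finrank F V + 1)
  have hli : LinearIndependent F v := LinearMap.linearIndependent_of_isOrthoᵢ (B := 𝓗.traceForm)
    (fun i j hij => by
      change 𝓗.traceForm (v i) (v j) = 0
      rw [traceForm_apply, h0 i j hij, map_zero])
    (fun i hi => h1 i (𝓗.eq_zero_of_trace_eq_zero (𝓗.hermitian _ _) hi))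
  have := hli.fintype_card_le_finrank
  simp at this

/-- There is a hermitian operator with a cyclic vector: a diagonal operator with distinct
eigenvalues `0, 1, …, k - 1` on an orthogonal basis, with the sum of the basis as cyclic vector. -/
theorem exists_isCyclicVector : ∃ S v, 𝓗.IsHerm S ∧ IsCyclicVector S v := by
  obtain ⟨k, v, h0, h1, hspan⟩ := 𝓗.exists_orthogonal_span
  have hc : ∀ i, ∃ c : F, algebraMap F E c * 𝓗.form (v i) (v i) = 1 := by
    intro i
    obtain ⟨a, ha⟩ := 𝓗.exists_of_ι_eq (𝓗.hermitian (v i) (v i))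
    have ha0 : a ≠ 0 := by
      rintro rfl
      exact h1 i (by rw [ha, map_zero])
    exact ⟨a⁻¹, by rw [ha, ← map_mul, inv_mul_cancel₀ ha0, map_one]⟩
  choose c hc using hc
  let S : Module.End E V := ∑ i : Fin k, (((i : ℕ) : F) * c i) • 𝓗.rankOne (v i) (v i)
  have hS : 𝓗.IsHerm S := by
    intro x y
    simp only [S, LinearMap.sum_apply, map_sum, LinearMap.smul_apply, rankOne_apply,
      form_smul_left_base, form_smul_right_base, form_smul_left, form_smul_right, 𝓗.hermitian]
    exact Finset.sum_congr rfl fun i _ => by ring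
  have hSv : ∀ i, S (v i) = ((i : ℕ) : F) • v i := by
    intro i
    simp only [S, LinearMap.sum_apply, LinearMap.smul_apply, rankOne_apply]
    rw [Finset.sum_eq_single i (fun j _ hj => by rw [h0 j i hj, zero_smul, smul_zero]) (by simp),
      mul_smul, ← algebraMap_smul E (c i), smul_smul, hc, one_smul]
  have hp : ∀ (p : F[X]) i, aeval S p (v i) = p.eval ((i : ℕ) : F) • v i := by
    intro p i
    induction p using Polynomial.induction_on' with
    | add p q hp hq => rw [map_add, LinearMap.add_apply, hp, hq, eval_add, add_smul]
    | monomial n a =>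
      have hpow : ∀ n : ℕ, (S ^ n) (v i) = (((i : ℕ) : F) ^ n) • v i := by
        intro n
        induction n with
        | zero => simp
        | succ n ih =>
          rw [pow_succ, Module.End.mul_apply, hSv, LinearMap.map_smul_of_tower, ih, smul_smul,
            pow_succ, mul_comm]
      rw [aeval_monomial, eval_monomial, ← Algebra.smul_def, LinearMap.smul_apply, hpow, smul_smul]
  refine ⟨S, ∑ i, v i, hS, ?_⟩
  have htop : LinearMap.range (evalAt S (∑ i, v i)) = ⊤ := by
    rw [eq_top_iff, ← hspan, Submodule.span_le]
    rintro _ ⟨i, rfl⟩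
    let p : F[X] := Lagrange.basis Finset.univ (fun j : Fin k => ((j : ℕ) : F)) i
    have hinj : Set.InjOn (fun j : Fin k => ((j : ℕ) : F)) (Finset.univ : Finset (Fin k)) :=
      fun a _ b _ h => Fin.ext (Nat.cast_injective h)
    -- The Lagrange polynomial at the eigenvalue `i` extracts `v i` from the sum.
    refine ⟨p.map (algebraMap F E), ?_⟩
    rw [evalAt_apply, aeval_map_algebraMap', map_sum, Finset.sum_eq_single i]
    · rw [hp, Lagrange.eval_basis_self hinj (Finset.mem_univ i), one_smul]
    · intro j _ hj
      have hz : p.eval ((j : ℕ) : F) = 0 := Lagrange.eval_basis_of_ne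
        (v := fun j : Fin k => ((j : ℕ) : F)) hj.symm (Finset.mem_univ j)
      rw [hp, hz, zero_smul]
    · simp
  intro w
  have : w ∈ LinearMap.range (evalAt S (∑ i, v i)) := htop ▸ Submodule.mem_top
  exact this

end Commutant

end HermitianSpace

/-! ### Hermitian operators representing elements of the imaginary dual -/

namespace ImaginaryDual

variable {F 𝔨 : Type*} [RCLike F]

/-- The element `i Re ℓ` of the imaginary dual attached to a linear form `ℓ`. -/
noncomputable def ofDual [AddCommGroup 𝔨] [Module F 𝔨] (ℓ : 𝔨 →ₗ[F] F) : ImaginaryDual F 𝔨 where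
  toAddMonoidHom :=
    { toFun := fun x => Complex.I * ((RCLike.re (ℓ x) : ℝ) : ℂ)
      map_zero' := by simp
      map_add' := fun x y => by simp [mul_add] }
  map_real_smul' r x := by simp; ring
  re_eq_zero' x := by simp

theorem toDual_ofDual [AddCommGroup 𝔨] [Module F 𝔨] (ℓ : 𝔨 →ₗ[F] F) :
    (ofDual ℓ).toDual = ℓ := by
  have him : ∀ x, (pairing x (ofDual ℓ)).im = RCLike.re (ℓ x) := by
    intro x
    simp [pairing, ofDual]
  ext x
  change ((pairing x (ofDual ℓ)).im : F) - RCLike.I * ((pairing (RCLike.I • x) (ofDual ℓ)).im : F)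
    = ℓ x
  have hre : (RCLike.re (RCLike.I * ℓ x) : ℝ) = -RCLike.im (ℓ x) := by
    rw [RCLike.mul_re, RCLike.I_re, zero_mul, zero_sub, mul_comm, RCLike.mul_im_I_ax]
  rw [him, him, map_smul, smul_eq_mul, hre, RCLike.ofReal_neg, mul_neg, sub_neg_eq_add, mul_comm,
    RCLike.re_add_im]

theorem toDual_injective [AddCommGroup 𝔨] [Module F 𝔨] :
    Function.Injective (toDual : ImaginaryDual F 𝔨 → 𝔨 →ₗ[F] F) := by
  intro ξ η h
  refine ext_pairing fun x => ?_
  rw [pairing_eq, pairing_eq, h]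

theorem toDual_comap {𝔩 : Type*} [AddCommGroup 𝔨] [Module F 𝔨] [AddCommGroup 𝔩] [Module F 𝔩]
    (f : 𝔩 →ₗ[F] 𝔨) (ξ : ImaginaryDual F 𝔨) : (comap f ξ).toDual = ξ.toDual ∘ₗ f := by
  ext x
  change ((pairing (f x) ξ).im : F) - RCLike.I * ((pairing (f (RCLike.I • x)) ξ).im : F) =
    ((pairing (f x) ξ).im : F) - RCLike.I * ((pairing (RCLike.I • f x) ξ).im : F)
  rw [map_smul]

theorem mem_centralizer_iff_toDual [LieRing 𝔨] [LieAlgebra F 𝔨] (x : 𝔨) (ξ : ImaginaryDual F 𝔨) :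
    x ∈ centralizer ξ ↔ ∀ y, ξ.toDual ⁅x, y⁆ = 0 := by
  rw [mem_centralizer_iff]
  refine ⟨fun h y => ?_, fun h y => by rw [pairing_eq, h]; simp⟩
  change ((pairing ⁅x, y⁆ ξ).im : F) - RCLike.I * ((pairing (RCLike.I • ⁅x, y⁆) ξ).im : F) = 0
  rw [← lie_smul, h, h]
  simp

end ImaginaryDual

namespace HermitianSpace

section Model

variable {F E V : Type*} [RCLike F] [CommRing E] [Algebra F E]
  [Algebra.IsQuadraticExtension F E] [AddCommGroup V] [Module E V] [Module F V]
  [IsScalarTower F E V] (𝓗 : HermitianSpace F E V)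

/-- A realization of a Lie algebra `𝔨` as the unitary Lie algebra of a hermitian space: a faithful
representation on the space whose image consists of the skew-hermitian operators. -/
structure Realization (𝔨 : Type*) [LieRing 𝔨] [LieAlgebra F 𝔨] where
  toEnd : 𝔨 →ₗ[F] Module.End E V
  injective : Function.Injective toEnd
  isSkew : ∀ x, 𝓗.IsSkew (toEnd x)
  surjective : ∀ a, 𝓗.IsSkew a → ∃ x, toEnd x = a
  map_lie : ∀ x y, toEnd ⁅x, y⁆ = toEnd x * toEnd y - toEnd y * toEnd x

variable {𝓗} {𝔨 : Type*} [LieRing 𝔨] [LieAlgebra F 𝔨] (φ : 𝓗.Realization 𝔨)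

/-- The operator `S` represents `τ`: the `F`-linear form of `τ` is `y ↦ tr_F (δ S y)`. That `S` is
hermitian is a separate hypothesis where it is needed. -/
def Represents (S : Module.End E V) (τ : ImaginaryDual F 𝔨) : Prop :=
  ∀ y, τ.toDual y = traceF F (𝓗.δ • S * φ.toEnd y)

variable [Module.Finite F V]

include φ in
theorem Realization.finite : Module.Finite F 𝔨 :=
  have := finite_end (F := F) (E := E) (V := V)
  Module.Finite.of_injective φ.toEnd φ.injective

theorem exists_isHerm_forall_eq (ℓ : 𝔨 →ₗ[F] F) :
    ∃ S, 𝓗.IsHerm S ∧ ∀ y, ℓ y = traceF F (𝓗.δ • S * φ.toEnd y) := by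
  have := φ.finite
  let B : LinearMap.BilinForm F 𝔨 := LinearMap.mk₂ F
    (fun x y => traceF F (φ.toEnd x * φ.toEnd y))
    (fun x y z => by rw [map_add, add_mul, map_add])
    (fun c x y => by rw [map_smul, smul_mul_assoc, map_smul])
    (fun x y z => by rw [map_add, mul_add, map_add])
    (fun c x y => by rw [map_smul, mul_smul_comm, map_smul])
  have hleft : ∀ x, (∀ y, B x y = 0) → x = 0 := by
    intro x hx
    apply φ.injective
    rw [map_zero]
    refine IsSkew.eq_zero_of_traceF 𝓗 (φ.isSkew x) fun b hb => ?_
    obtain ⟨y, rfl⟩ := φ.surjective b hb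
    exact hx y
  have hB : B.Nondegenerate := ⟨hleft, fun y hy => hleft y fun x => by
    have h : traceF F (φ.toEnd x * φ.toEnd y) = 0 := hy x
    rw [traceF_mul_comm] at h
    exact h⟩
  obtain ⟨T, hT⟩ := (B.toDual hB).surjective ℓ
  refine ⟨𝓗.δinv • φ.toEnd T, (φ.isSkew T).δinv_smul, fun y => ?_⟩
  rw [δ_smul_δinv_smul, ← hT]
  rfl

theorem exists_represents (τ : ImaginaryDual F 𝔨) : ∃ S, 𝓗.IsHerm S ∧ Represents φ S τ :=
  exists_isHerm_forall_eq φ τ.toDual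

theorem exists_represented (S : Module.End E V) : ∃ τ : ImaginaryDual F 𝔨, Represents φ S τ := by
  let ℓ : 𝔨 →ₗ[F] F := traceF F ∘ₗ LinearMap.mulLeft F (𝓗.δ • S) ∘ₗ φ.toEnd
  exact ⟨ImaginaryDual.ofDual ℓ, fun y => by rw [ImaginaryDual.toDual_ofDual]; rfl⟩

variable {φ} in
/-- The representing hermitian operator is unique. -/
theorem Represents.unique {S S' : Module.End E V} {τ : ImaginaryDual F 𝔨} (hS : 𝓗.IsHerm S)
    (hS' : 𝓗.IsHerm S') (h : Represents φ S τ) (h' : Represents φ S' τ) : S = S' := by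
  have h1 : 𝓗.IsHerm (S - S') := fun v w => by
    simp only [LinearMap.sub_apply, map_sub, hS v w, hS' v w]
  have h2 : 𝓗.δ • (S - S') = 0 := by
    refine IsSkew.eq_zero_of_traceF 𝓗 h1.δ_smul fun b hb => ?_
    obtain ⟨y, rfl⟩ := φ.surjective b hb
    rw [smul_sub, sub_mul, map_sub, ← h, ← h', sub_self]
  rw [← sub_eq_zero]
  ext v
  exact δ_smul_eq_zero (𝓗 := 𝓗) (LinearMap.congr_fun h2 v)

variable {φ} in
theorem Represents.mem_centralizer_iff {S : Module.End E V} {τ : ImaginaryDual F 𝔨}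
    (hS : 𝓗.IsHerm S) (h : Represents φ S τ) (x : 𝔨) :
    x ∈ τ.centralizer ↔ Commute S (φ.toEnd x) := by
  set a := φ.toEnd x with ha
  have hcomm : ∀ y, τ.toDual ⁅x, y⁆ = traceF F (𝓗.δ • (S * a - a * S) * φ.toEnd y) := by
    intro y
    rw [h, φ.map_lie, ← ha, mul_sub, map_sub, smul_sub, sub_mul, map_sub]
    have h1 : traceF F (𝓗.δ • S * (φ.toEnd y * a)) = traceF F (𝓗.δ • (a * S) * φ.toEnd y) := by
      rw [← mul_assoc, traceF_mul_comm, smul_mul_assoc, mul_smul_comm, smul_mul_assoc, mul_assoc]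
    rw [h1]
    simp only [smul_mul_assoc, mul_assoc]
  rw [ImaginaryDual.mem_centralizer_iff_toDual]
  constructor
  · intro h0
    have h1 : 𝓗.IsHerm (S * a - a * S) := fun v w => by
      have h2 := φ.isSkew x (S v) w
      have h3 := φ.isSkew x v (S w)
      rw [← ha] at h2 h3
      have h4 := hS v (a w)
      have h5 := hS (a v) w
      simp only [LinearMap.sub_apply, Module.End.mul_apply, map_sub]
      linear_combination h3 - h2 + h4 + h5
    have h2 : 𝓗.δ • (S * a - a * S) = 0 := by
      refine IsSkew.eq_zero_of_traceF 𝓗 h1.δ_smul fun b hb => ?_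
      obtain ⟨y, rfl⟩ := φ.surjective b hb
      rw [← hcomm, h0]
    refine sub_eq_zero.1 ?_
    ext v
    exact δ_smul_eq_zero (𝓗 := 𝓗) (LinearMap.congr_fun h2 v)
  · intro h0 y
    rw [hcomm, h0.eq, sub_self, smul_zero, zero_mul, map_zero]

variable {φ} in
theorem Represents.finrank_centralizer {S : Module.End E V} {τ : ImaginaryDual F 𝔨}
    (hS : 𝓗.IsHerm S) (h : Represents φ S τ) :
    Module.finrank F τ.centralizer = Module.finrank F (𝓗.skewCommutant S) := by
  have h1 : 𝓗.skewCommutant S = τ.centralizer.map φ.toEnd := by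
    ext a
    simp only [mem_skewCommutant, Submodule.mem_map, h.mem_centralizer_iff hS]
    constructor
    · rintro ⟨ha, hc⟩
      obtain ⟨x, rfl⟩ := φ.surjective a ha
      exact ⟨x, hc, rfl⟩
    · rintro ⟨x, hx, rfl⟩
      exact ⟨φ.isSkew x, hx⟩
  rw [h1]
  exact (Submodule.equivMapOfInjective φ.toEnd φ.injective τ.centralizer).finrank_eq

variable {φ} in
/-- An element of the imaginary dual is regular if and only if the representing hermitian operator
has a cyclic vector. -/
theorem Represents.isRegular_iff {S : Module.End E V} {τ : ImaginaryDual F 𝔨}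
    (hS : 𝓗.IsHerm S) (h : Represents φ S τ) :
    τ.IsRegular ↔ ∃ v, IsCyclicVector S v := by
  constructor
  · intro hreg
    obtain ⟨S₀, v₀, hS₀, hv₀⟩ := 𝓗.exists_isCyclicVector
    obtain ⟨τ₀, hτ₀⟩ := exists_represented φ S₀
    have h1 := hreg τ₀
    rw [h.finrank_centralizer hS, hτ₀.finrank_centralizer hS₀] at h1
    have h2 := 𝓗.finrank_skewCommutant_le_of_isCyclicVector hv₀
    exact 𝓗.exists_isCyclicVector_of_finrank_le hS (by omega)
  · rintro ⟨v, hv⟩ η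
    obtain ⟨S', hS', hη⟩ := exists_represents φ η
    rw [h.finrank_centralizer hS, hη.finrank_centralizer hS']
    have h1 := 𝓗.finrank_skewCommutant_le_of_isCyclicVector hv
    have h2 := 𝓗.finrank_le_of_isHerm hS'
    omega

end Model

end HermitianSpace

/-! ### The hermitian spaces attached to a unitary GGP pair -/

section Quadratic

variable {F E : Type*} [Field F] [CharZero F] [CommRing E] [Algebra F E]
  [Algebra.IsQuadraticExtension F E]

theorem exists_repr_of_forall_ne {x : E} (hxF : ∀ a : F, x ≠ algebraMap F E a) (y : E) :
    ∃ a b : F, y = algebraMap F E a + algebraMap F E b * x := by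
  have hfr := Algebra.IsQuadraticExtension.finrank_eq_two F E
  have : Module.Finite F E := Module.finite_of_finrank_pos (by omega)
  have hnt : Nontrivial E := Module.nontrivial_of_finrank_pos (R := F) (by omega)
  have hli : LinearIndependent F ![(1 : E), x] := by
    rw [LinearIndependent.pair_iff]
    intro s t hst
    have ht : t = 0 := by
      by_contra ht
      apply hxF (-(t⁻¹ * s))
      have h1 : t • x = -(s • (1 : E)) := eq_neg_of_add_eq_zero_right hst
      rw [map_neg, Algebra.algebraMap_eq_smul_one, mul_smul, ← smul_neg, ← h1, smul_smul,
        inv_mul_cancel₀ ht, one_smul]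
    subst ht
    rw [zero_smul, add_zero] at hst
    exact ⟨(smul_eq_zero.1 hst).resolve_right one_ne_zero, rfl⟩
  have hspan := hli.span_eq_top_of_card_eq_finrank (by simp [hfr])
  have hy : y ∈ Submodule.span F (Set.range ![(1 : E), x]) := hspan ▸ Submodule.mem_top
  rw [Matrix.range_cons_cons_empty, Submodule.mem_span_pair] at hy
  obtain ⟨a, b, rfl⟩ := hy
  exact ⟨a, b, by rw [Algebra.smul_def, Algebra.smul_def, mul_one]⟩

/-- Completing the square: a generator may be shifted so that its square lies in `F`. -/
theorem exists_mul_self_eq_algebraMap {x : E} (hxF : ∀ a : F, x ≠ algebraMap F E a) :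
    ∃ (c d : F), (x - algebraMap F E c) * (x - algebraMap F E c) = algebraMap F E d := by
  obtain ⟨p, q, hpq⟩ := exists_repr_of_forall_ne hxF (x * x)
  have hq : algebraMap F E q = 2 * algebraMap F E (q / 2) := by
    rw [← map_ofNat (algebraMap F E) 2, ← map_mul, mul_div_cancel₀ q two_ne_zero]
  refine ⟨q / 2, p + (q / 2) ^ 2, ?_⟩
  rw [map_add, map_pow]
  linear_combination hpq + x * hq

theorem ι_eq_neg_of_mul_self_eq {ι : E ≃ₐ[F] E} {δ : E} {d : F} (hd : d ≠ 0)
    (hδ : δ * δ = algebraMap F E d) (hδF : ∀ a : F, δ ≠ algebraMap F E a) (hι : ι δ ≠ δ) :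
    ι δ = -δ := by
  have hnt : Nontrivial E := ⟨⟨_, _, hι⟩⟩
  obtain ⟨a, b, hab⟩ := exists_repr_of_forall_ne hδF (ι δ)
  have hb0 : b ≠ 0 := by
    rintro rfl
    apply hδF a
    apply ι.injective
    rw [hab, ι.commutes, map_zero, zero_mul, add_zero]
  have hsq : algebraMap F E (2 * a * b) * δ = -algebraMap F E (a ^ 2 + b ^ 2 * d - d) := by
    have h1 : ι δ * ι δ = algebraMap F E d := by rw [← map_mul, hδ, ι.commutes]
    rw [hab] at h1
    simp only [map_sub, map_add, map_mul, map_pow, map_ofNat]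
    linear_combination h1 - (algebraMap F E b) ^ 2 * hδ
  have ha : a = 0 := by
    by_contra ha
    have h0 : 2 * a * b ≠ 0 := mul_ne_zero (mul_ne_zero two_ne_zero ha) hb0
    apply hδF ((2 * a * b)⁻¹ * -(a ^ 2 + b ^ 2 * d - d))
    rw [map_mul, map_neg, ← hsq, ← mul_assoc, ← map_mul, inv_mul_cancel₀ h0, map_one, one_mul]
  subst ha
  rw [mul_zero, zero_mul, map_zero, zero_mul, zero_eq_neg,
    map_eq_zero_iff _ (algebraMap F E).injective] at hsq
  have h3 : (b - 1) * (b + 1) = 0 :=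
    (mul_eq_zero.1 (by linear_combination hsq : (b - 1) * (b + 1) * d = 0)).resolve_right hd
  rw [map_zero, zero_add] at hab
  rcases mul_eq_zero.1 h3 with h4 | h4
  · rw [sub_eq_zero.1 h4, map_one, one_mul] at hab
    exact absurd hab hι
  · rw [hab, eq_neg_of_add_eq_zero_left h4, map_neg, map_one, neg_one_mul]

/-- A quadratic étale algebra with a nontrivial automorphism `ι` is `F ⊕ F δ` with `δ ^ 2 ∈ Fˣ` and
`ι δ = -δ`. Of étaleness only reducedness is needed. -/
theorem exists_quadratic_generator [IsReduced E] (ι : E ≃ₐ[F] E) (hι : ι ≠ AlgEquiv.refl) :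
    ∃ (δ : E) (d : F), ι δ = -δ ∧ d ≠ 0 ∧ δ * δ = algebraMap F E d ∧
      ∀ x : E, ∃ a b : F, x = algebraMap F E a + algebraMap F E b * δ := by
  obtain ⟨x, hx⟩ : ∃ x, ι x ≠ x := by
    by_contra! h
    exact hι (AlgEquiv.ext h)
  have hxF : ∀ a : F, x ≠ algebraMap F E a := by
    rintro a rfl
    exact hx (ι.commutes a)
  obtain ⟨c, d, hδ⟩ := exists_mul_self_eq_algebraMap hxF
  have hδF : ∀ a : F, x - algebraMap F E c ≠ algebraMap F E a := fun a ha => hxF (a + c) (by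
    rw [map_add, ← ha, sub_add_cancel])
  have hd : d ≠ 0 := by
    rintro rfl
    have h0 : x - algebraMap F E c = 0 := IsReduced.eq_zero _ ⟨2, by rw [pow_two, hδ, map_zero]⟩
    exact hδF 0 (by rw [h0, map_zero])
  refine ⟨x - algebraMap F E c, d, ι_eq_neg_of_mul_self_eq hd hδ hδF fun h => hx ?_, hd, hδ,
    exists_repr_of_forall_ne hδF⟩
  rw [map_sub, ι.commutes] at h
  exact sub_left_injective h

end Quadratic

namespace UnitaryGGPPair

open HermitianSpace

variable {F E V : Type*} [RCLike F] [CommRing E] [Algebra F E]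
    [Algebra.IsQuadraticExtension F E] [Algebra.Etale F E]
    [AddCommGroup V] [Module E V]
    (P : UnitaryGGPPair F E V)

include P in
theorem exists_generator : ∃ (δ : E) (d : F), P.ι δ = -δ ∧ d ≠ 0 ∧ δ * δ = algebraMap F E d ∧
      ∀ x : E, ∃ a b : F, x = algebraMap F E a + algebraMap F E b * δ :=
  have : IsReduced E := Algebra.FormallyUnramified.isReduced_of_field F E
  exists_quadratic_generator P.ι P.ι_ne_refl

/-- The hermitian space `V`, with a chosen generator `δ` of `E`. -/
noncomputable def space : HermitianSpace F E V where
  ι := P.ι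
  form := P.form
  hermitian := P.hermitian
  separating := P.nondegenerate.1
  δ := P.exists_generator.choose
  d := P.exists_generator.choose_spec.choose
  ι_δ := P.exists_generator.choose_spec.choose_spec.1
  d_ne_zero := P.exists_generator.choose_spec.choose_spec.2.1
  δ_mul_δ := P.exists_generator.choose_spec.choose_spec.2.2.1
  exists_repr := P.exists_generator.choose_spec.choose_spec.2.2.2

theorem exists_norm_e : ∃ c : F, c ≠ 0 ∧ P.form P.e P.e = algebraMap F E c := by
  obtain ⟨c, hc⟩ := P.space.exists_of_ι_eq (P.hermitian P.e P.e)
  refine ⟨c, ?_, hc⟩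
  rintro rfl
  rw [map_zero] at hc
  have hnt : Nontrivial E := Module.nontrivial_of_finrank_pos (R := F)
    (by rw [Algebra.IsQuadraticExtension.finrank_eq_two F E]; norm_num)
  have h1 := P.nondegenerate_e.1 ⟨P.e, Submodule.mem_span_singleton_self P.e⟩ (by
    rintro ⟨w, hw⟩
    obtain ⟨a, rfl⟩ := Submodule.mem_span_singleton.1 hw
    change P.form P.e (a • P.e) = 0
    rw [map_smul, hc, smul_zero])
  have h2 : P.e = 0 := congrArg Subtype.val h1
  exact one_ne_zero (P.free_e (show (1 : E) • P.e = (0 : E) • P.e by rw [h2, smul_zero, smul_zero]))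

/-- The inverse of `⟨e, e⟩`. -/
noncomputable def normInv : F := P.exists_norm_e.choose⁻¹

theorem normInv_ne_zero : P.normInv ≠ 0 := inv_ne_zero P.exists_norm_e.choose_spec.1

theorem normInv_mul : algebraMap F E P.normInv * P.form P.e P.e = 1 := by
  rw [P.exists_norm_e.choose_spec.2, ← map_mul, normInv,
    inv_mul_cancel₀ P.exists_norm_e.choose_spec.1, map_one]

/-- The coefficient of `e` in the decomposition `V = V_H ⊕ E e`. -/
noncomputable def coeffE : V →ₗ[E] E := algebraMap F E P.normInv • P.form P.e

theorem coeffE_apply (v : V) : P.coeffE v = algebraMap F E P.normInv * P.form P.e v := rfl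

theorem coeffE_e : P.coeffE P.e = 1 := P.normInv_mul

theorem coeffE_eq_zero_iff (v : V) : P.coeffE v = 0 ↔ v ∈ P.VH := by
  rw [mem_VH_iff, coeffE_apply]
  refine ⟨fun h => ?_, fun h => by rw [h, mul_zero]⟩
  linear_combination (P.form P.e P.e) * h - P.form P.e v * P.normInv_mul

/-- The orthogonal projection of `V` onto `V_H`. -/
noncomputable def projH : V →ₗ[E] P.VH :=
  (LinearMap.id - P.coeffE.smulRight P.e).codRestrict P.VH fun v => by
    rw [← coeffE_eq_zero_iff]
    simp [P.coeffE_e]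

theorem coe_projH (v : V) : (P.projH v : V) = v - P.coeffE v • P.e := rfl

theorem projH_add (v : V) : (P.projH v : V) + P.coeffE v • P.e = v := by
  rw [coe_projH, sub_add_cancel]

theorem projH_coe (v : P.VH) : P.projH v = v := by
  apply Subtype.ext
  rw [coe_projH, (P.coeffE_eq_zero_iff _).2 v.2, zero_smul, sub_zero]

theorem projH_e : P.projH P.e = 0 := by
  apply Subtype.ext
  rw [coe_projH, coeffE_e, one_smul, sub_self]
  rfl

theorem form_e_VH (v : P.VH) : P.form P.e v = 0 := (P.mem_VH_iff _).1 v.2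

theorem form_VH_e (v : P.VH) : P.form v P.e = 0 := by rw [← P.hermitian, form_e_VH, map_zero]

theorem form_VH_projH (v : P.VH) (w : V) : P.form v (P.projH w) = P.form v w := by
  rw [coe_projH, map_sub, map_smul, form_VH_e, smul_zero, sub_zero]

theorem form_projH_VH (v : P.VH) (w : V) : P.form (P.projH w) v = P.form w v := by
  rw [← P.hermitian, form_VH_projH, P.hermitian]

/-- The hermitian space `V_H`, with the same generator `δ` as for `V`. -/
noncomputable def spaceH : HermitianSpace F E P.VH where
  ι := P.ι
  form := P.form.domRestrict₁₂ P.VH P.VH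
  hermitian v w := P.hermitian v w
  separating v h := by
    apply Subtype.ext
    refine P.nondegenerate.1 _ fun w => ?_
    rw [← form_VH_projH]
    exact h (P.projH w)
  δ := P.space.δ
  d := P.space.d
  ι_δ := P.space.ι_δ
  d_ne_zero := P.space.d_ne_zero
  δ_mul_δ := P.space.δ_mul_δ
  exists_repr := P.space.exists_repr

theorem spaceH_form (v w : P.VH) : P.spaceH.form v w = P.form v w := rfl

theorem spaceH_δ : P.spaceH.δ = P.space.δ := rfl

/-- The extension by zero on `E e` of an operator on `V_H`. -/
noncomputable def extend (a : Module.End E P.VH) : Module.End E V :=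
  P.VH.subtype ∘ₗ a ∘ₗ P.projH

theorem extend_apply (a : Module.End E P.VH) (v : V) : P.extend a v = a (P.projH v) := rfl

theorem extend_VH (a : Module.End E P.VH) (v : P.VH) : P.extend a v = a v := by
  rw [extend_apply, projH_coe]

theorem extend_e (a : Module.End E P.VH) : P.extend a P.e = 0 := by
  rw [extend_apply, projH_e, map_zero]; rfl

/-- The compression to `V_H` of an operator on `V`. -/
noncomputable def compress (a : Module.End E V) : Module.End E P.VH :=
  P.projH ∘ₗ a ∘ₗ P.VH.subtype

theorem compress_apply (a : Module.End E V) (v : P.VH) : P.compress a v = P.projH (a v) := rfl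

variable [Module F V] [IsScalarTower F E V]

theorem isHerm_compress {a : Module.End E V} (ha : P.space.IsHerm a) :
    P.spaceH.IsHerm (P.compress a) := by
  intro v w
  rw [spaceH_form, spaceH_form, compress_apply, compress_apply, form_projH_VH, form_VH_projH]
  exact ha v w

theorem isSkew_extend {a : Module.End E P.VH} (ha : P.spaceH.IsSkew a) :
    P.space.IsSkew (P.extend a) := by
  intro v w
  have h := ha (P.projH v) (P.projH w)
  rw [spaceH_form, spaceH_form, form_VH_projH, form_projH_VH] at h
  exact h

/-- The realization of `𝔤` on `V`. -/
def realization : P.space.Realization P.𝔤 where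
  toEnd := P.𝔤.toSubmodule.subtype
  injective := Subtype.val_injective
  isSkew x := x.2
  surjective a ha := ⟨⟨a, ha⟩, rfl⟩
  map_lie _ _ := rfl

theorem realization_toEnd (x : P.𝔤) : P.realization.toEnd x = (x : Module.End E V) := rfl

/-- The realization of `𝔥` on `V_H`. -/
noncomputable def realizationH : P.spaceH.Realization P.𝔥 where
  toEnd :=
    { toFun := fun y => ((y : P.𝔤) : Module.End E V).restrict y.2.1
      map_add' := fun _ _ => rfl
      map_smul' := fun _ _ => rfl }
  injective x y h := by
    apply Subtype.ext
    apply Subtype.ext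
    ext v
    rw [← P.projH_add v, map_add, map_add, map_smul, map_smul, x.2.2, y.2.2]
    congr 1
    exact congrArg Subtype.val (LinearMap.congr_fun h (P.projH v))
  isSkew y v w := (y : P.𝔤).2 v w
  surjective a ha := by
    refine ⟨⟨⟨P.extend a, P.isSkew_extend ha⟩, fun v _ => (a (P.projH v)).2, P.extend_e a⟩, ?_⟩
    ext v
    exact P.extend_VH a v
  map_lie _ _ := rfl

theorem coe_realizationH_toEnd (y : P.𝔥) (v : P.VH) :
    (P.realizationH.toEnd y v : V) = ((y : P.𝔤) : Module.End E V) v := rfl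

theorem extend_realizationH_toEnd (y : P.𝔥) :
    P.extend (P.realizationH.toEnd y) = ((y : P.𝔤) : Module.End E V) := by
  ext v
  rw [extend_apply, coe_realizationH_toEnd, coe_projH, map_sub, map_smul, y.2.2, smul_zero,
    sub_zero]

variable [Module.Finite F V]

instance finite_VH : Module.Finite F P.VH :=
  Module.Finite.of_injective (P.VH.subtype.restrictScalars F) Subtype.val_injective

/-- If `S` represents `τ`, then its compression to `V_H` represents `τ_H`. -/
theorem represents_compress {S : Module.End E V} {τ : ImaginaryDual F P.𝔤}
    (h : Represents P.realization S τ) : Represents P.realizationH (P.compress S) (P.restr τ) := by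
  intro y
  have h1 : (P.restr τ).toDual y = τ.toDual (y : P.𝔤) := rfl
  rw [h1, h, realization_toEnd, ← extend_realizationH_toEnd, spaceH_δ]
  have h2 := LinearMap.trace_comp_comm' (R := F)
    ((P.realizationH.toEnd y ∘ₗ P.projH).restrictScalars F)
    ((P.space.δ • S ∘ₗ P.VH.subtype).restrictScalars F)
  refine h2.trans ?_
  rw [traceF_mul_comm]
  refine congrArg (LinearMap.trace F P.VH) ?_
  ext v
  simp [compress]

end UnitaryGGPPair

namespace HermitianSpace

/-! ### Centers, and operators commuting with a cyclic one -/

section Center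

open Polynomial

variable {F E V : Type*} [Field F] [CharZero F] [CommRing E] [Algebra F E]
  [Algebra.IsQuadraticExtension F E] [AddCommGroup V] [Module E V] [Module F V]
  [IsScalarTower F E V] (𝓗 : HermitianSpace F E V)

theorem traceForm_δ_smul (v w : V) :
    𝓗.traceForm (𝓗.δ • v) (𝓗.δ • w) = -𝓗.d * 𝓗.traceForm v w := by
  rw [traceForm_apply, traceForm_apply, form_smul_left, form_smul_right, ← mul_assoc, 𝓗.ι_δ,
    neg_mul, 𝓗.δ_mul_δ, ← map_neg, ← Algebra.smul_def, map_smul, smul_eq_mul]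

theorem rankOne_δ_smul_sub (u w : V) : 𝓗.rankOne (𝓗.δ • w) u - 𝓗.rankOne u (𝓗.δ • w) =
    𝓗.δ • (𝓗.rankOne u w + 𝓗.rankOne w u) := by
  ext x
  simp only [LinearMap.sub_apply, LinearMap.smul_apply, LinearMap.add_apply, rankOne_apply,
    form_smul_left, 𝓗.ι_δ, smul_add, smul_smul, neg_mul, neg_smul, sub_neg_eq_add]
  rw [mul_comm 𝓗.δ (𝓗.form u x), add_comm]

variable {𝓗} in
/-- The center of the unitary Lie algebra consists of scalars. -/
theorem IsSkew.exists_eq_smul_of_forall_commute {z : Module.End E V} (hz : 𝓗.IsSkew z)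
    (h : ∀ b, 𝓗.IsSkew b → Commute z b) : ∃ c : F, ∀ v, z v = (algebraMap F E c * 𝓗.δ) • v := by
  -- `z` commutes with the sum and the difference of the operators `v⟨w, ·⟩` and `w⟨v, ·⟩`.
  have hrank : ∀ u w, Commute z (𝓗.rankOne u w) := by
    intro u w
    have h1 := h _ (𝓗.isSkew_rankOne_sub u w)
    have h2 := h _ (𝓗.isSkew_rankOne_sub (𝓗.δ • w) u)
    rw [rankOne_δ_smul_sub] at h2
    have h3 := h2.smul_right 𝓗.δinv
    rw [δinv_smul_δ_smul] at h3
    have h4 := (h1.add_right h3).smul_right (2⁻¹ : F)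
    rwa [sub_add_add_cancel, ← two_smul F, smul_smul, inv_mul_cancel₀ two_ne_zero, one_smul] at h4
  by_cases hV : ∀ v, 𝓗.form v v = 0
  · have h1 := 𝓗.isHerm_one.eq_zero 𝓗 hV
    have h0 : ∀ v : V, v = 0 := fun v => LinearMap.congr_fun h1 v
    exact ⟨0, fun v => by rw [h0 (z v), h0 v, smul_zero]⟩
  push Not at hV
  obtain ⟨v₀, hv₀⟩ := hV
  obtain ⟨a, ha⟩ := 𝓗.exists_of_ι_eq (𝓗.hermitian v₀ v₀)
  have ha0 : a ≠ 0 := by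
    rintro rfl
    exact hv₀ (by rw [ha, map_zero])
  have hskew : 𝓗.ι (𝓗.form v₀ (z v₀)) = -𝓗.form v₀ (z v₀) := by
    rw [𝓗.hermitian]
    exact eq_neg_of_add_eq_zero_left (hz v₀ v₀)
  obtain ⟨b, hb⟩ := 𝓗.exists_of_ι_eq_neg hskew
  refine ⟨a⁻¹ * b, fun v => ?_⟩
  have h1 := LinearMap.congr_fun (hrank v v₀).eq v₀
  rw [Module.End.mul_apply, Module.End.mul_apply, rankOne_apply, rankOne_apply, map_smul, ha, hb]
    at h1
  have h2 := congrArg (algebraMap F E a⁻¹ • ·) h1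
  simp only [smul_smul] at h2
  rw [← map_mul, inv_mul_cancel₀ ha0, map_one, one_smul, ← mul_assoc, ← map_mul] at h2
  exact h2

variable {𝓗} in
/-- If `S` has a cyclic vector, its hermitian commutant is `F[S]`. -/
theorem IsHerm.exists_aeval_eq {S x : Module.End E V} (hS : 𝓗.IsHerm S) {v : V}
    (hv : IsCyclicVector S v) (hx : 𝓗.IsHerm x) (hc : Commute S x) :
    ∃ p : F[X], x = aeval S p := by
  obtain ⟨p, hp⟩ := hv (x v)
  have h1 : x = aeval S p := by
    rw [← sub_eq_zero]
    refine hv.eq_zero (hc.sub_right (commute_aeval (Commute.refl S) p).symm) ?_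
    rw [LinearMap.sub_apply, hp, sub_self]
  obtain ⟨p₁, p₂, h2⟩ := 𝓗.exists_aeval_eq S p
  have h3 : 𝓗.δ • aeval S p₂ = 0 := by
    refine (hS.polynomial p₂).δ_smul.eq_zero_of_isHerm fun v w => ?_
    have h4 : 𝓗.δ • aeval S p₂ = x - aeval S p₁ := by rw [h1, h2, add_sub_cancel_left]
    rw [h4, LinearMap.sub_apply, LinearMap.sub_apply, map_sub, map_sub, LinearMap.sub_apply, hx,
      hS.polynomial p₁]
  exact ⟨p₁, by rw [h1, h2, h3, add_zero]⟩

variable {𝓗} in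
theorem IsHerm.form_aeval_aeval {S : Module.End E V} (hS : 𝓗.IsHerm S) (u : V) (q r : F[X]) :
    𝓗.form (aeval S q u) (aeval S r u) = 𝓗.form u (aeval S (q * r) u) := by
  rw [hS.polynomial q, map_mul, Module.End.mul_apply]

variable {𝓗} in
theorem IsHerm.ι_form_aeval_aeval {S : Module.End E V} (hS : 𝓗.IsHerm S) (u : V) (q r : F[X]) :
    𝓗.ι (𝓗.form (aeval S q u) (aeval S r u)) = 𝓗.form (aeval S q u) (aeval S r u) := by
  rw [hS.form_aeval_aeval, (hS.polynomial _).ι_form]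

variable {𝓗} in
/-- The form is nondegenerate on `F[S] u` if `u` is a cyclic vector. -/
theorem IsCyclicVector.aeval_eq_zero {S : Module.End E V} (hS : 𝓗.IsHerm S) {u : V}
    (hu : IsCyclicVector S u) (r : F[X])
    (h : ∀ q : F[X], 𝓗.traceForm (aeval S q u) (aeval S r u) = 0) : aeval S r u = 0 := by
  have h1 : ∀ q : F[X], 𝓗.form (aeval S q u) (aeval S r u) = 0 := fun q =>
    𝓗.eq_zero_of_trace_eq_zero (hS.ι_form_aeval_aeval u q r) (h q)
  refine 𝓗.separating_right fun w => ?_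
  obtain ⟨p, rfl⟩ := hu w
  obtain ⟨p₁, p₂, hp⟩ := 𝓗.exists_aeval_eq S p
  rw [hp, LinearMap.add_apply, LinearMap.smul_apply, map_add, LinearMap.add_apply, form_smul_left,
    h1, h1, mul_zero, add_zero]

variable {𝓗} in
/-- If `S` has some cyclic vector, evaluation at `u` is injective on `F[S]`, and the form is
nondegenerate on `F[S] u`, then `u` is a cyclic vector: evaluation at `u` is then injective on the
commutant `F[S] ⊕ δ F[S]`, whose dimension is at least that of `V`. -/
theorem IsHerm.isCyclicVector [Module.Finite F V] {S : Module.End E V} (hS : 𝓗.IsHerm S)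
    (hcyc : ∃ v, IsCyclicVector S v) {u : V}
    (h : ∀ q : F[X], (∀ r : F[X], 𝓗.traceForm (aeval S r u) (aeval S q u) = 0) → aeval S q = 0) :
    IsCyclicVector S u := by
  have := finite_end (F := F) (E := E) (V := V)
  obtain ⟨v, hv⟩ := hcyc
  have hrep : ∀ a ∈ 𝓗.skewCommutant S, ∃ q : F[X], a = 𝓗.δ • aeval S q := by
    intro a ha
    obtain ⟨q, hq⟩ := hS.exists_aeval_eq hv ha.1.δinv_smul (ha.2.smul_right _)
    exact ⟨q, by rw [← hq, δ_smul_δinv_smul]⟩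
  have hinj : Function.Injective (𝓗.evalPair S u) := by
    rw [← LinearMap.ker_eq_bot, LinearMap.ker_eq_bot']
    rintro ⟨⟨a, ha⟩, ⟨b, hb⟩⟩ h0
    obtain ⟨q₁, rfl⟩ := hrep a ha
    obtain ⟨q₂, rfl⟩ := hrep b hb
    have h1 : aeval S q₁ u + 𝓗.δ • aeval S q₂ u = 0 :=
      δ_smul_eq_zero (𝓗 := 𝓗) (by rw [smul_add]; exact h0)
    -- Pairing with `F[S] u` separates the components in `F` and `δ F`.
    have h2 : ∀ r : F[X], 𝓗.form (aeval S r u) (aeval S q₁ u) = 0 ∧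
        𝓗.form (aeval S r u) (aeval S q₂ u) = 0 := by
      intro r
      have h3 := congrArg (𝓗.form (aeval S r u)) h1
      rw [map_add, form_smul_right, map_zero] at h3
      have h4 := congrArg 𝓗.ι h3
      rw [map_add, map_mul, hS.ι_form_aeval_aeval, hS.ι_form_aeval_aeval, 𝓗.ι_δ, map_zero] at h4
      have h5 : (2 : E) • 𝓗.form (aeval S r u) (aeval S q₁ u) = 0 := by
        rw [smul_eq_mul]
        linear_combination h3 + h4
      have h6 := two_smul_eq_zero F h5
      rw [h6, zero_add] at h3
      exact ⟨h6, δ_mul_eq_zero h3⟩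
    have h7 := h q₁ fun r => by rw [traceForm_apply, (h2 r).1, map_zero]
    have h8 := h q₂ fun r => by rw [traceForm_apply, (h2 r).2, map_zero]
    simp [h7, h8]
  have hrank : Module.finrank F (𝓗.skewCommutant S × 𝓗.skewCommutant S) = Module.finrank F V := by
    refine le_antisymm (LinearMap.finrank_le_finrank_of_injective hinj) ?_
    rw [Module.finrank_prod, ← two_mul]
    exact 𝓗.finrank_le_of_isHerm hS
  have hsurj := (LinearMap.injective_iff_surjective_of_finrank_eq_finrank hrank).1 hinj
  intro w
  obtain ⟨⟨⟨a, ha⟩, ⟨b, hb⟩⟩, rfl⟩ := hsurj w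
  obtain ⟨q₁, rfl⟩ := hrep a ha
  obtain ⟨q₂, rfl⟩ := hrep b hb
  refine ⟨C 𝓗.δ * (q₁.map (algebraMap F E) + C 𝓗.δ * q₂.map (algebraMap F E)), ?_⟩
  simp only [map_mul, map_add, aeval_C, aeval_map_algebraMap', ← Algebra.smul_def,
    smul_add, LinearMap.add_apply]
  rfl

end Center

end HermitianSpace

namespace UnitaryGGPPair

/-! ### Cyclic vectors and the compression to the complement of `e` -/

open HermitianSpace Polynomial

variable {F E V : Type*} [RCLike F] [CommRing E] [Algebra F E]
    [Algebra.IsQuadraticExtension F E] [Algebra.Etale F E]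
    [AddCommGroup V] [Module E V] [Module F V] [IsScalarTower F E V]
    (P : UnitaryGGPPair F E V)

theorem projH_apply_eq (S : Module.End E V) (v : V) :
    P.projH (S v) = P.compress S (P.projH v) + P.coeffE v • P.projH (S P.e) := by
  conv_lhs => rw [← P.projH_add v]
  rw [map_add, map_add, map_smul, map_smul, compress_apply]

/-- `e` is a cyclic vector of `S` if and only if the component of `S e` in `V_H` is a cyclic vector
of the compression of `S`. -/
theorem isCyclicVector_iff (S : Module.End E V) :
    IsCyclicVector S P.e ↔ IsCyclicVector (P.compress S) (P.projH (S P.e)) := by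
  set u := P.projH (S P.e) with hu
  constructor
  · intro h w
    have main : ∀ p : E[X],
        P.projH (aeval S p P.e) ∈ LinearMap.range (evalAt (P.compress S) u) := by
      intro p
      induction p using Polynomial.induction_on' with
      | add p q hp hq => rw [map_add, LinearMap.add_apply, map_add]; exact add_mem hp hq
      | monomial n a =>
        have hn : ∀ n : ℕ, P.projH ((S ^ n) P.e) ∈ LinearMap.range (evalAt (P.compress S) u) := by
          intro n
          induction n with
          | zero =>
            rw [pow_zero, Module.End.one_apply, projH_e]
            exact zero_mem _
          | succ n ih =>
            rw [pow_succ', Module.End.mul_apply, projH_apply_eq]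
            refine add_mem ?_ (Submodule.smul_mem _ _ ⟨1, by simp [evalAt_apply, hu]⟩)
            obtain ⟨q, hq⟩ := ih
            rw [← hq]
            exact ⟨X * q, by rw [evalAt_apply, map_mul, aeval_X]; rfl⟩
        rw [aeval_monomial, ← Algebra.smul_def, LinearMap.smul_apply, map_smul]
        exact Submodule.smul_mem _ _ (hn n)
    obtain ⟨p, hp⟩ := h w
    have h1 := main p
    rw [hp, projH_coe] at h1
    exact h1
  · intro h w
    have he : P.e ∈ LinearMap.range (evalAt S P.e) := ⟨1, by simp [evalAt_apply]⟩
    have hS : ∀ v ∈ LinearMap.range (evalAt S P.e), S v ∈ LinearMap.range (evalAt S P.e) := by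
      rintro _ ⟨q, rfl⟩
      exact ⟨X * q, by rw [evalAt_apply, map_mul, aeval_X]; rfl⟩
    have hproj : ∀ v ∈ LinearMap.range (evalAt S P.e),
        (P.projH v : V) ∈ LinearMap.range (evalAt S P.e) := by
      intro v hv
      rw [coe_projH]
      exact sub_mem hv (Submodule.smul_mem _ _ he)
    have main : ∀ p : E[X],
        (aeval (P.compress S) p u : V) ∈ LinearMap.range (evalAt S P.e) := by
      intro p
      induction p using Polynomial.induction_on' with
      | add p q hp hq => rw [map_add, LinearMap.add_apply]; exact add_mem hp hq
      | monomial n a =>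
        have hn : ∀ n : ℕ, ((P.compress S ^ n) u : V) ∈ LinearMap.range (evalAt S P.e) := by
          intro n
          induction n with
          | zero => exact hproj _ (hS _ he)
          | succ n ih =>
            rw [pow_succ', Module.End.mul_apply, compress_apply]
            exact hproj _ (hS _ ih)
        rw [aeval_monomial, ← Algebra.smul_def, LinearMap.smul_apply]
        exact Submodule.smul_mem _ _ (hn n)
    obtain ⟨p, hp⟩ := h (P.projH w)
    have h1 := main p
    rw [hp] at h1
    have h2 : w ∈ LinearMap.range (evalAt S P.e) := by
      rw [← P.projH_add w]
      exact add_mem h1 (Submodule.smul_mem _ _ he)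
    exact h2

theorem exists_coeffE_eq {S : Module.End E V} (hS : P.space.IsHerm S) :
    ∃ a : F, P.coeffE (S P.e) = algebraMap F E a := by
  obtain ⟨b, hb⟩ := P.space.exists_of_ι_eq (hS.ι_form P.e)
  exact ⟨P.normInv * b, by rw [coeffE_apply, map_mul, ← hb]; rfl⟩

/-- The projection to `V_H` of `F[S] e` is contained in `F[S_H] u`, where `u` is the component of
`S e` in `V_H`. -/
theorem exists_projH_aeval_eq {S : Module.End E V} (hS : P.space.IsHerm S) (p : F[X]) :
    ∃ r : F[X], P.projH (aeval S p P.e) = aeval (P.compress S) r (P.projH (S P.e)) := by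
  induction p using Polynomial.induction_on' with
  | add p q hp hq =>
    obtain ⟨r₁, h₁⟩ := hp
    obtain ⟨r₂, h₂⟩ := hq
    exact ⟨r₁ + r₂, by rw [map_add, LinearMap.add_apply, map_add, h₁, h₂, map_add,
      LinearMap.add_apply]⟩
  | monomial n c =>
    obtain ⟨r, hr⟩ : ∃ r : F[X],
        P.projH ((S ^ n) P.e) = aeval (P.compress S) r (P.projH (S P.e)) := by
      induction n with
      | zero => exact ⟨0, by rw [pow_zero, Module.End.one_apply, projH_e, map_zero]; rfl⟩
      | succ n ih =>
        obtain ⟨r, hr⟩ := ih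
        obtain ⟨a, ha⟩ := P.exists_coeffE_eq (hS.pow n)
        refine ⟨X * r + C a, ?_⟩
        rw [pow_succ', Module.End.mul_apply, projH_apply_eq, hr, ha, map_add, map_mul, aeval_X,
          aeval_C, LinearMap.add_apply, Module.End.mul_apply, Module.algebraMap_end_apply,
          algebraMap_smul]
    refine ⟨C c * r, ?_⟩
    rw [aeval_monomial, ← Algebra.smul_def, LinearMap.smul_apply, LinearMap.map_smul_of_tower, hr,
      map_mul, aeval_C, Module.End.mul_apply, Module.algebraMap_end_apply]

/-- Conversely, `F[S_H] u` is contained in the projection to `V_H` of `F[S] e`. -/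
theorem exists_aeval_eq_projH {S : Module.End E V} (hS : P.space.IsHerm S) (r : F[X]) :
    ∃ p : F[X], P.projH (aeval S p P.e) = aeval (P.compress S) r (P.projH (S P.e)) := by
  induction r using Polynomial.induction_on' with
  | add p q hp hq =>
    obtain ⟨r₁, h₁⟩ := hp
    obtain ⟨r₂, h₂⟩ := hq
    exact ⟨r₁ + r₂, by rw [map_add, LinearMap.add_apply, map_add, h₁, h₂, map_add,
      LinearMap.add_apply]⟩
  | monomial n c =>
    obtain ⟨p, hp⟩ : ∃ p : F[X],
        P.projH (aeval S p P.e) = (P.compress S ^ n) (P.projH (S P.e)) := by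
      induction n with
      | zero => exact ⟨X, by rw [aeval_X, pow_zero, Module.End.one_apply]⟩
      | succ n ih =>
        obtain ⟨p, hp⟩ := ih
        obtain ⟨a, ha⟩ := P.exists_coeffE_eq (hS.polynomial p)
        refine ⟨X * p - C a * X, ?_⟩
        rw [pow_succ', Module.End.mul_apply, ← hp, map_sub, map_mul, map_mul, aeval_X, aeval_C,
          LinearMap.sub_apply, map_sub, Module.End.mul_apply, projH_apply_eq, ha,
          Module.End.mul_apply, Module.algebraMap_end_apply, LinearMap.map_smul_of_tower,
          algebraMap_smul, add_sub_cancel_right]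
    refine ⟨C c * p, ?_⟩
    rw [aeval_monomial, ← Algebra.smul_def, LinearMap.smul_apply, ← hp, map_mul, aeval_C,
      Module.End.mul_apply, Module.algebraMap_end_apply, LinearMap.map_smul_of_tower]

end UnitaryGGPPair

namespace UnitaryGGPPair

/-! ### The bilinear form on the centralizers -/

open HermitianSpace Polynomial

variable {F E V : Type*} [RCLike F] [CommRing E] [Algebra F E]
    [Algebra.IsQuadraticExtension F E] [Algebra.Etale F E]
    [AddCommGroup V] [Module E V] [Module F V] [IsScalarTower F E V]
    (P : UnitaryGGPPair F E V)

theorem smul_mem_center (c : F) (x : P.𝔤) (h : ∀ v, (x : Module.End E V) v =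
    (algebraMap F E c * P.space.δ) • v) : x ∈ LieAlgebra.center F P.𝔤 := by
  refine (LieModule.mem_maxTrivSubmodule F P.𝔤 P.𝔤 x).2 fun y => ?_
  apply Subtype.ext
  ext v
  change (y : Module.End E V) ((x : Module.End E V) v) -
    (x : Module.End E V) ((y : Module.End E V) v) = 0
  rw [h, h, map_smul, sub_self]

variable [Module.Finite F V]

/-- A nonzero central element of `𝔥` is a nonzero scalar `c δ` on `V_H`. -/
theorem exists_eq_smul_projH {z : P.𝔥} (hz : z ∈ LieAlgebra.center F P.𝔥) (hz0 : z ≠ 0) :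
    ∃ c : F, c ≠ 0 ∧ ∀ v, ((z : P.𝔤) : Module.End E V) v =
      (algebraMap F E c * P.space.δ) • (P.projH v : V) := by
  have hcomm : ∀ b, P.spaceH.IsSkew b → Commute (P.realizationH.toEnd z) b := by
    intro b hb
    obtain ⟨y, rfl⟩ := P.realizationH.surjective b hb
    have h1 : ⁅y, z⁆ = 0 := (LieModule.mem_maxTrivSubmodule F P.𝔥 P.𝔥 z).1 hz y
    have h2 := P.realizationH.map_lie y z
    rw [h1, map_zero] at h2
    exact (sub_eq_zero.1 h2.symm).symm
  obtain ⟨c, hc⟩ := (P.realizationH.isSkew z).exists_eq_smul_of_forall_commute hcomm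
  refine ⟨c, ?_, fun v => ?_⟩
  · rintro rfl
    apply hz0
    apply P.realizationH.injective
    ext v
    rw [hc, map_zero, map_zero, zero_mul, zero_smul, LinearMap.zero_apply]
  · rw [← extend_realizationH_toEnd, extend_apply, hc]
    rfl

/-- The form `⟨[z, [x, y]], τ⟩` in terms of the hermitian operator `S` representing `τ`: up to a
nonzero constant it is `tr ⟨y S e, x e⟩`. -/
theorem toDual_lie_lie {S : Module.End E V} (hS : P.space.IsHerm S) {τ : ImaginaryDual F P.𝔤}
    (h : Represents P.realization S τ) {z : P.𝔥} {c : F}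
    (hz : ∀ v, ((z : P.𝔤) : Module.End E V) v =
      (algebraMap F E c * P.space.δ) • (P.projH v : V)) (x : P.𝔤) (y : P.𝔥) :
    τ.toDual ⁅(z : P.𝔤), ⁅x, (y : P.𝔤)⁆⁆ = 2 * c * P.space.d * P.normInv *
      P.spaceH.traceForm (P.realizationH.toEnd y (P.projH (S P.e)))
        (P.projH ((x : Module.End E V) P.e)) := by
  set X := (x : Module.End E V) with hX
  set Y := ((y : P.𝔤) : Module.End E V) with hY
  set M : Module.End E V := X * Y - Y * X with hM
  set Q := P.space.rankOne P.e P.e with hQ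
  have hxskew : ∀ v w, P.space.traceForm (X v) w = -P.space.traceForm v (X w) := fun v w => by
    rw [traceForm_apply, traceForm_apply, ← map_neg]
    exact congrArg _ (eq_neg_of_add_eq_zero_left (x.2 v w))
  have hyskew : ∀ v w, P.space.traceForm (Y v) w = -P.space.traceForm v (Y w) := fun v w => by
    rw [traceForm_apply, traceForm_apply, ← map_neg]
    exact congrArg _ (eq_neg_of_add_eq_zero_left ((y : P.𝔤).2 v w))
  have hSherm : ∀ v w, P.space.traceForm (S v) w = P.space.traceForm v (S w) := fun v w => by
    rw [traceForm_apply, traceForm_apply, hS]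
  have hye : Y P.e = 0 := y.2.2
  have hzQ : ((z : P.𝔤) : Module.End E V) =
      (algebraMap F E c * P.space.δ) • (1 - P.normInv • Q) := by
    ext v
    rw [hz, coe_projH, LinearMap.smul_apply, LinearMap.sub_apply, LinearMap.smul_apply,
      coeffE_apply, hQ, rankOne_apply, ← algebraMap_smul E P.normInv, smul_smul]
    rfl
  have hδ : P.space.δ * (algebraMap F E c * P.space.δ) = algebraMap F E (c * P.space.d) := by
    rw [mul_left_comm, P.space.δ_mul_δ, map_mul]
  have h1 : P.space.δ • S * (P.realization.toEnd ⁅(z : P.𝔤), ⁅x, (y : P.𝔤)⁆⁆) =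
      (c * P.space.d * P.normInv) • (S * (M * Q) - S * (Q * M)) := by
    have h2 : P.realization.toEnd ⁅(z : P.𝔤), ⁅x, (y : P.𝔤)⁆⁆ =
        (algebraMap F E c * P.space.δ) • P.normInv • (M * Q - Q * M) := by
      rw [P.realization.map_lie, P.realization.map_lie]
      change ((z : P.𝔤) : Module.End E V) * M - M * ((z : P.𝔤) : Module.End E V) = _
      rw [hzQ]
      simp only [smul_mul_assoc, mul_smul_comm, sub_mul, mul_sub, one_mul, mul_one, smul_sub]
      abel
    rw [h2, smul_mul_assoc, mul_smul_comm, mul_smul_comm, smul_smul, hδ, algebraMap_smul, smul_smul,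
      mul_sub]
  have h3 : traceF F (S * (M * Q)) = P.space.traceForm (Y (S P.e)) (X P.e) := by
    rw [← mul_assoc, hQ, mul_rankOne, traceF_rankOne, Module.End.mul_apply, ← hSherm, hM,
      LinearMap.sub_apply, Module.End.mul_apply, Module.End.mul_apply, hye, map_zero, zero_sub,
      map_neg, hyskew]
  have h4 : traceF F (S * (Q * M)) = -P.space.traceForm (Y (S P.e)) (X P.e) := by
    have h5 := hyskew P.e (X (S P.e))
    rw [hye, map_zero, LinearMap.zero_apply] at h5
    have h6 := hxskew P.e (Y (S P.e))
    rw [traceF_mul_comm, mul_assoc, traceF_mul_comm, hQ, mul_rankOne, traceF_rankOne,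
      Module.End.mul_apply, hM, LinearMap.sub_apply, Module.End.mul_apply, Module.End.mul_apply,
      map_sub, P.space.traceForm_comm (Y (S P.e))]
    linear_combination h6 - h5
  have h7 : P.space.traceForm (Y (S P.e)) (X P.e) =
      P.spaceH.traceForm (P.realizationH.toEnd y (P.projH (S P.e))) (P.projH (X P.e)) := by
    have h8 : Y (S P.e) = P.realizationH.toEnd y (P.projH (S P.e)) := by
      rw [hY, ← extend_realizationH_toEnd, extend_apply]
    rw [traceForm_apply, traceForm_apply, h8, spaceH_form, form_VH_projH]
    rfl
  rw [h, h1, map_smul, map_sub, h3, h4, h7, smul_eq_mul]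
  ring

/-- If `S` and its compression `S_H` have cyclic vectors and the stability form has no kernel on the
side of `𝔥_{τ_H}`, then `e` is a cyclic vector of `S`: if `q(S_H) u` is orthogonal to `F[S_H] u`,
where `u` is the component of `S e` in `V_H`, then `δ q(S_H)` is in the kernel. -/
theorem isCyclicVector_of_stabilityForm_nondegenerate {S : Module.End E V} (hS : P.space.IsHerm S)
    {τ : ImaginaryDual F P.𝔤} (h : Represents P.realization S τ) {z : P.𝔥}
    (hz : z ∈ LieAlgebra.center F P.𝔥) (hz0 : z ≠ 0) (hcyc : ∃ v, IsCyclicVector S v)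
    (hcycH : ∃ v, IsCyclicVector (P.compress S) v)
    (hnd : (P.stabilityForm τ z).SeparatingRight) : IsCyclicVector S P.e := by
  rw [isCyclicVector_iff]
  obtain ⟨c, -, hc⟩ := P.exists_eq_smul_projH hz hz0
  obtain ⟨v, hv⟩ := hcyc
  have hSH := P.isHerm_compress hS
  have hH := P.represents_compress h
  set u := P.projH (S P.e) with hu
  refine hSH.isCyclicVector hcycH fun q hq => ?_
  obtain ⟨y, hy⟩ := P.realizationH.surjective _ (hSH.polynomial q).δ_smul
  have hyc : y ∈ (P.restr τ).centralizer := by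
    rw [hH.mem_centralizer_iff hSH, hy, ← aeval_map_algebraMap']
    exact ((commute_aeval (Commute.refl _) _).symm).smul_right _
  have hy0 : (⟨y, hyc⟩ : (P.restr τ).centralizer) = 0 := by
    refine hnd _ fun x => ?_
    obtain ⟨⟨x, hx⟩, rfl⟩ := Submodule.Quotient.mk_surjective _ x
    change τ.toDual ⁅(z : P.𝔤), ⁅x, (y : P.𝔤)⁆⁆ = 0
    rw [P.toDual_lie_lie hS h hc]
    rw [h.mem_centralizer_iff hS] at hx
    obtain ⟨p, hp⟩ := hS.exists_aeval_eq hv (P.realization.isSkew x).δinv_smul (hx.smul_right _)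
    have hx' : (x : Module.End E V) = P.space.δ • aeval S p := by
      rw [← hp, δ_smul_δinv_smul]; rfl
    obtain ⟨r, hr⟩ := P.exists_projH_aeval_eq hS p
    rw [hx', hy, LinearMap.smul_apply, LinearMap.smul_apply, map_smul P.projH, hr, ← spaceH_δ,
      traceForm_δ_smul, P.spaceH.traceForm_comm, hq, mul_zero, mul_zero]
  have hy0' : y = 0 := congrArg Subtype.val hy0
  rw [hy0', map_zero] at hy
  ext w
  exact congrArg Subtype.val (δ_smul_eq_zero (𝓗 := P.spaceH) (LinearMap.congr_fun hy.symm w))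

/-- If `e` is a cyclic vector of `S`, then `u`, the component of `S e` in `V_H`, is one of `S_H`. An
element `δ p(S)` of the kernel of the stability form has `p(S) e ∈ F e`, so `p(S)` is a scalar; an
element `δ q(S_H)` has `q(S_H) u = 0`, so `q(S_H) = 0`. -/
theorem stabilityForm_nondegenerate_of_isCyclicVector {S : Module.End E V} (hS : P.space.IsHerm S)
    {τ : ImaginaryDual F P.𝔤} (h : Represents P.realization S τ) {z : P.𝔥}
    (hz : z ∈ LieAlgebra.center F P.𝔥) (hz0 : z ≠ 0) (hcyc : IsCyclicVector S P.e) :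
    (P.stabilityForm τ z).Nondegenerate := by
  obtain ⟨c, hc0, hc⟩ := P.exists_eq_smul_projH hz hz0
  have hcycH := (P.isCyclicVector_iff S).1 hcyc
  have hSH := P.isHerm_compress hS
  have hH := P.represents_compress h
  set u := P.projH (S P.e) with hu
  have hconst : 2 * c * P.space.d * P.normInv ≠ 0 :=
    mul_ne_zero (mul_ne_zero (mul_ne_zero two_ne_zero hc0) P.space.d_ne_zero) P.normInv_ne_zero
  -- The stability form on `δ p(S)` and `δ q(S_H)`.
  have hform : ∀ (x : P.𝔤) (y : P.𝔥) (p : F[X]) (q r : F[X]),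
      (x : Module.End E V) = P.space.δ • aeval S p →
      P.realizationH.toEnd y = P.spaceH.δ • aeval (P.compress S) q →
      P.projH (aeval S p P.e) = aeval (P.compress S) r u →
      τ.toDual ⁅(z : P.𝔤), ⁅x, (y : P.𝔤)⁆⁆ = 0 →
      P.spaceH.traceForm (aeval (P.compress S) q u) (aeval (P.compress S) r u) = 0 := by
    intro x y p q r hx hy hr h0
    rw [P.toDual_lie_lie hS h hc, hx, hy, LinearMap.smul_apply, LinearMap.smul_apply,
      map_smul P.projH, hr, ← spaceH_δ, traceForm_δ_smul] at h0
    exact (mul_eq_zero.1 ((mul_eq_zero.1 h0).resolve_left hconst)).resolve_left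
      (neg_ne_zero.2 P.spaceH.d_ne_zero)
  have hcomm : ∀ q : F[X], Commute (P.compress S) (aeval (P.compress S) q) := fun q => by
    rw [← aeval_map_algebraMap']
    exact (commute_aeval (Commute.refl _) _).symm
  constructor
  · intro x hx
    obtain ⟨⟨x, hxc⟩, rfl⟩ := Submodule.Quotient.mk_surjective _ x
    rw [Submodule.Quotient.mk_eq_zero]
    have hxc' := (h.mem_centralizer_iff hS x).1 hxc
    obtain ⟨p, hp⟩ := hS.exists_aeval_eq hcyc (P.realization.isSkew x).δinv_smul
      (hxc'.smul_right _)
    have hx' : (x : Module.End E V) = P.space.δ • aeval S p := by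
      rw [← hp, δ_smul_δinv_smul]; rfl
    obtain ⟨r, hr⟩ := P.exists_projH_aeval_eq hS p
    have h1 : aeval (P.compress S) r u = 0 := by
      refine hcycH.aeval_eq_zero hSH r fun q => ?_
      obtain ⟨y, hy⟩ := P.realizationH.surjective _ (hSH.polynomial q).δ_smul
      have hyc : y ∈ (P.restr τ).centralizer := by
        rw [hH.mem_centralizer_iff hSH, hy]
        exact (hcomm q).smul_right _
      exact hform x y p q r hx' hy hr (hx ⟨y, hyc⟩)
    obtain ⟨a, ha⟩ := P.exists_coeffE_eq (hS.polynomial p)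
    have h2 : aeval S p P.e = a • P.e := by
      rw [← P.projH_add (aeval S p P.e), hr, h1, ha, algebraMap_smul, Submodule.coe_zero, zero_add]
    have h3 : aeval S p = a • (1 : Module.End E V) := by
      rw [← sub_eq_zero]
      refine hcyc.eq_zero ?_ ?_
      · refine Commute.sub_right ?_ ((Commute.one_right S).smul_right a)
        rw [← aeval_map_algebraMap']
        exact (commute_aeval (Commute.refl _) _).symm
      · rw [LinearMap.sub_apply, h2, LinearMap.smul_apply, Module.End.one_apply, sub_self]
    refine P.smul_mem_center a x fun v => ?_
    rw [hx', h3, LinearMap.smul_apply, LinearMap.smul_apply, Module.End.one_apply,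
      ← algebraMap_smul E a, smul_smul, mul_comm]
  · rintro ⟨y, hyc⟩ hy0
    have hyc' := (hH.mem_centralizer_iff hSH y).1 hyc
    obtain ⟨q, hq⟩ := hSH.exists_aeval_eq hcycH (P.realizationH.isSkew y).δinv_smul
      (hyc'.smul_right _)
    have hy' : P.realizationH.toEnd y = P.spaceH.δ • aeval (P.compress S) q := by
      rw [← hq]
      exact (P.spaceH.δ_smul_δinv_smul (P.realizationH.toEnd y)).symm
    have h1 : aeval (P.compress S) q u = 0 := by
      refine hcycH.aeval_eq_zero hSH q fun r => ?_
      obtain ⟨p, hp⟩ := P.exists_aeval_eq_projH hS r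
      obtain ⟨x, hx⟩ := P.realization.surjective _ (hS.polynomial p).δ_smul
      have hxc : x ∈ τ.centralizer := by
        rw [h.mem_centralizer_iff hS, hx, ← aeval_map_algebraMap']
        exact ((commute_aeval (Commute.refl _) _).symm).smul_right _
      rw [P.spaceH.traceForm_comm]
      exact hform x y p q r hx hy' hp (hy0 (Submodule.Quotient.mk ⟨x, hxc⟩))
    have h2 : aeval (P.compress S) q = 0 := hcycH.eq_zero (hcomm q) h1
    apply Subtype.ext
    apply P.realizationH.injective
    rw [hy', h2, smul_zero]
    exact (map_zero _).symm

end UnitaryGGPPair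

namespace UnitaryGGPPair

/-! ### The group action on representing operators -/

open HermitianSpace Polynomial

variable {F E V : Type*} [RCLike F] [CommRing E] [Algebra F E]
    [Algebra.IsQuadraticExtension F E] [Algebra.Etale F E]
    [AddCommGroup V] [Module E V] [Module F V] [IsScalarTower F E V]
    (P : UnitaryGGPPair F E V)

/-- The operator on `V` underlying an element of `G`. -/
def opG (g : P.G) : Module.End E V := ((g : V ≃ₗ[E] V) : V →ₗ[E] V)

theorem opG_form (g : P.G) (v w : V) : P.space.form (P.opG g v) (P.opG g w) = P.space.form v w :=
  g.2 v w

theorem opG_mul (g h : P.G) : P.opG (g * h) = P.opG g * P.opG h := rfl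

theorem opG_one : P.opG 1 = 1 := rfl

theorem opG_mul_inv (g : P.G) : P.opG g * P.opG g⁻¹ = 1 := by
  rw [← opG_mul, mul_inv_cancel, opG_one]

theorem opG_inv_mul (g : P.G) : P.opG g⁻¹ * P.opG g = 1 := by
  rw [← opG_mul, inv_mul_cancel, opG_one]

theorem opG_injective {g h : P.G} (hgh : P.opG g = P.opG h) : g = h :=
  Subtype.ext (LinearEquiv.toLinearMap_injective hgh)

theorem opG_H_e (h : P.H) : P.opG h P.e = P.e := h.2.2

theorem isHerm_conj {S : Module.End E V} (hS : P.space.IsHerm S) (g : P.G) :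
    P.space.IsHerm (P.opG g * S * P.opG g⁻¹) := by
  have hinv : ∀ v, P.opG g (P.opG g⁻¹ v) = v := LinearMap.congr_fun (P.opG_mul_inv g)
  intro v w
  have h1 := P.opG_form g (S (P.opG g⁻¹ v)) (P.opG g⁻¹ w)
  have h2 := P.opG_form g (P.opG g⁻¹ v) (S (P.opG g⁻¹ w))
  rw [hinv] at h1 h2
  simp only [Module.End.mul_apply]
  rw [h1, h2, hS]

variable [Module.Finite F V]

theorem represents_smul {S S' : Module.End E V} {ξ : ImaginaryDual F P.𝔤}
    (h : Represents P.realization S ξ) {g : P.G} (hS' : S' * P.opG g = P.opG g * S) :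
    Represents P.realization S' (g • ξ) := by
  intro y
  have h1 : (g • ξ).toDual y = ξ.toDual (P.Ad g⁻¹ y) :=
    LinearMap.congr_fun (ImaginaryDual.toDual_comap (P.Ad g⁻¹) ξ) y
  have h2 : P.realization.toEnd (P.Ad g⁻¹ y) = P.opG g⁻¹ * P.realization.toEnd y * P.opG g := by
    change P.opG g⁻¹ * (y : Module.End E V) * P.opG g⁻¹⁻¹ = _
    rw [inv_inv]; rfl
  rw [h1, h, h2, ← mul_assoc, traceF_mul_comm, ← mul_assoc, ← mul_assoc, mul_smul_comm, ← hS',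
    smul_mul_assoc, mul_assoc S', P.opG_mul_inv, mul_one]

theorem eq_of_represents {S : Module.End E V} {ξ η : ImaginaryDual F P.𝔤}
    (h : Represents P.realization S ξ) (h' : Represents P.realization S η) : ξ = η :=
  ImaginaryDual.toDual_injective (LinearMap.ext fun y => by rw [h, h'])

theorem smul_eq_self {S : Module.End E V} {ξ : ImaginaryDual F P.𝔤}
    (h : Represents P.realization S ξ) {g : P.G} (hg : Commute S (P.opG g)) : g • ξ = ξ :=
  P.eq_of_represents (P.represents_smul h hg.eq) h

theorem represents_conj {S : Module.End E V} {ξ : ImaginaryDual F P.𝔤}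
    (h : Represents P.realization S ξ) (g : P.G) :
    Represents P.realization (P.opG g * S * P.opG g⁻¹) (g • ξ) :=
  P.represents_smul h (by rw [mul_assoc, P.opG_inv_mul, mul_one])

/-- The element of `H` given by an isometry of `V` fixing `e`. -/
theorem exists_mem_H (a : Module.End E V)
    (ha : ∀ v w, P.space.form (a v) (a w) = P.space.form v w) (he : a P.e = P.e) :
    ∃ h : P.H, P.opG h = a := by
  have hinj : Function.Injective a := by
    rw [← LinearMap.ker_eq_bot, LinearMap.ker_eq_bot']
    intro v hv
    refine P.space.separating v fun w => ?_
    rw [← ha, hv, map_zero, LinearMap.zero_apply]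
  have hsurj : Function.Surjective a :=
    (LinearMap.injective_iff_surjective (f := a.restrictScalars F)).1 hinj
  let g : V ≃ₗ[E] V := LinearEquiv.ofBijective a ⟨hinj, hsurj⟩
  refine ⟨⟨⟨g, ha⟩, fun v hv => ?_, he⟩, ?_⟩
  · rw [mem_VH_iff] at hv ⊢
    rw [← hv]
    conv_lhs => rw [← he]
    exact ha P.e v
  · ext v
    rfl

/-! ### Cyclic vectors give stable elements -/

/-- If `e` is a cyclic vector of `S`, then the stabilizer of `τ` in `H` is trivial. -/
theorem eq_one_of_smul_eq {S : Module.End E V} (hS : P.space.IsHerm S) {τ : ImaginaryDual F P.𝔤}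
    (h : Represents P.realization S τ) (hcyc : IsCyclicVector S P.e) {k : P.H}
    (hk : k • τ = τ) : k = 1 := by
  have h1 : Represents P.realization (P.opG k * S * P.opG (k : P.G)⁻¹) τ := by
    have := P.represents_conj h (k : P.G)
    rwa [show (k : P.G) • τ = τ from hk] at this
  have h2 := h.unique hS (P.isHerm_conj hS k) h1
  have h3 : Commute S (P.opG k) := by
    change S * P.opG k = P.opG k * S
    conv_lhs => rw [h2, mul_assoc, P.opG_inv_mul, mul_one]
  have h4 : P.opG k - 1 = 0 := by
    refine hcyc.eq_zero (h3.sub_right (Commute.one_right S)) ?_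
    rw [LinearMap.sub_apply, opG_H_e, Module.End.one_apply, sub_self]
  exact Subtype.ext (P.opG_injective (sub_eq_zero.1 h4))

/-- The matrix coefficients of the powers of the hermitian operator representing `ξ` are polynomial
functions of `ξ`: those of `S` itself are the values of `ξ` at skew-hermitian operators of rank at
most two. The polynomial is independent of `ξ`. -/
theorem exists_polynomial (n : ℕ) (v w : V) : ∃ p : MvPolynomial P.𝔤 F,
    ∀ (S : Module.End E V) (ξ : ImaginaryDual F P.𝔤), P.space.IsHerm S →
      Represents P.realization S ξ →
      MvPolynomial.eval (fun x => ξ.toDual x) p = P.space.traceForm w ((S ^ n) v) := by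
  induction n generalizing v with
  | zero => exact ⟨MvPolynomial.C (P.space.traceForm w v), fun S ξ _ _ => by simp⟩
  | succ n ih =>
    let b := Module.finBasis F V
    have hlin : ∀ k, ∃ p : MvPolynomial P.𝔤 F, ∀ (S : Module.End E V) (ξ : ImaginaryDual F P.𝔤),
        P.space.IsHerm S → Represents P.realization S ξ →
        MvPolynomial.eval (fun x => ξ.toDual x) p = b.repr (S v) k := by
      intro k
      obtain ⟨d, hd⟩ := (P.space.traceForm.toDual P.space.traceForm_nondegenerate).surjective
        (b.coord k)
      have hd' : ∀ u, P.space.traceForm d u = b.repr u k := fun u => LinearMap.congr_fun hd u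
      obtain ⟨y, hy⟩ := P.realization.surjective _
        (P.space.isSkew_rankOne_sub (P.space.δinv • v) d)
      refine ⟨MvPolynomial.C 2⁻¹ * MvPolynomial.X y, fun S ξ hS h => ?_⟩
      have h1 : P.space.traceForm (P.space.δinv • v) ((P.space.δ • S) d) =
          -P.space.traceForm d (S v) := by
        rw [traceForm_apply, traceForm_apply, LinearMap.smul_apply, form_smul_left, form_smul_right,
          ← mul_assoc, P.space.ι_δinv, neg_mul, P.space.δinv_mul_δ, neg_one_mul, map_neg, ← hS,
          ← traceForm_apply, ← traceForm_apply, P.space.traceForm_comm]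
      have h2 : (P.space.δ • S) (P.space.δinv • v) = S v := by
        rw [LinearMap.smul_apply, map_smul, P.space.δ_smul_δinv_smul]
      rw [map_mul, MvPolynomial.eval_C, MvPolynomial.eval_X, h, hy, mul_sub, map_sub, mul_rankOne,
        mul_rankOne, traceF_rankOne, traceF_rankOne, h1, h2, sub_neg_eq_add, ← two_mul,
        inv_mul_cancel_left₀ two_ne_zero, hd']
    choose p hp using hlin
    choose q hq using fun k => ih (b k)
    refine ⟨∑ k, p k * q k, fun S ξ hS h => ?_⟩
    rw [map_sum, pow_succ, Module.End.mul_apply]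
    conv_rhs => rw [← b.sum_repr (S v), map_sum, map_sum]
    refine Finset.sum_congr rfl fun k _ => ?_
    rw [map_mul, hp k S ξ hS h, hq k S ξ hS h, LinearMap.map_smul_of_tower, map_smul, smul_eq_mul]

/-- The moments `tr ⟨e, Sⁿ e⟩` determine the form on `E[S] e`. -/
theorem form_aeval_aeval_eq {S S' : Module.End E V} (hS : P.space.IsHerm S)
    (hS' : P.space.IsHerm S')
    (h : ∀ n : ℕ, P.space.traceForm P.e ((S' ^ n) P.e) = P.space.traceForm P.e ((S ^ n) P.e))
    (p q : E[X]) : P.space.form (aeval S' p P.e) (aeval S' q P.e) =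
      P.space.form (aeval S p P.e) (aeval S q P.e) := by
  have h0 : ∀ n, P.space.form P.e ((S' ^ n) P.e) = P.space.form P.e ((S ^ n) P.e) := by
    intro n
    rw [← sub_eq_zero]
    refine P.space.eq_zero_of_trace_eq_zero ?_ ?_
    · rw [map_sub, (hS.pow n).ι_form, (hS'.pow n).ι_form]
    · rw [map_sub, ← traceForm_apply, ← traceForm_apply, h, sub_self]
  induction p using Polynomial.induction_on' with
  | add p p' hp hp' =>
    simp only [map_add, LinearMap.add_apply, hp, hp']
  | monomial n a =>
    induction q using Polynomial.induction_on' with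
    | add q q' hq hq' => simp only [map_add, LinearMap.add_apply, hq, hq']
    | monomial m b =>
      simp only [aeval_monomial, ← Algebra.smul_def, LinearMap.smul_apply, form_smul_left,
        form_smul_right]
      rw [hS.pow n, hS'.pow n, ← Module.End.mul_apply, ← Module.End.mul_apply, ← pow_add, ← pow_add,
        h0]

/-- If `e` is a cyclic vector of `S`, then the moments `tr ⟨e, Sⁿ e⟩` determine the `H`-orbit. -/
theorem mem_orbit_of_traceForm_eq {S S' : Module.End E V} (hS : P.space.IsHerm S)
    (hS' : P.space.IsHerm S') {τ ξ : ImaginaryDual F P.𝔤} (hτ : Represents P.realization S τ)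
    (hξ : Represents P.realization S' ξ) (hcyc : IsCyclicVector S P.e)
    (h : ∀ n : ℕ, P.space.traceForm P.e ((S' ^ n) P.e) = P.space.traceForm P.e ((S ^ n) P.e)) :
    ξ ∈ MulAction.orbit P.H τ := by
  have hform := P.form_aeval_aeval_eq hS hS' h
  set Φ := evalAt S P.e with hΦ
  set Φ' := evalAt S' P.e with hΦ'
  have hle : LinearMap.ker Φ' ≤ LinearMap.ker Φ := by
    intro p hp
    rw [LinearMap.mem_ker] at hp ⊢
    refine P.space.separating _ fun w => ?_
    obtain ⟨q, rfl⟩ := hcyc w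
    exact (hform p q).symm.trans (by
      rw [show aeval S' p P.e = 0 from hp, map_zero, LinearMap.zero_apply])
  -- The isometry `p(S') e ↦ p(S) e`. It maps onto `V`, so that `E[S'] e = V` for dimension reasons.
  let k₀ : LinearMap.range Φ' →ₗ[E] V := (LinearMap.ker Φ').liftQ Φ hle ∘ₗ
    Φ'.quotKerEquivRange.symm.toLinearMap
  have hk₀ : ∀ p : E[X], ∀ hp : Φ' p ∈ LinearMap.range Φ', k₀ ⟨Φ' p, hp⟩ = Φ p := by
    intro p hp
    have : Φ'.quotKerEquivRange.symm ⟨Φ' p, hp⟩ = Submodule.Quotient.mk p := by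
      rw [LinearEquiv.symm_apply_eq]
      rfl
    simp only [k₀, LinearMap.comp_apply, LinearEquiv.coe_coe, this]
    rfl
  have hk₀surj : Function.Surjective (k₀.restrictScalars F) := by
    intro w
    obtain ⟨q, rfl⟩ := hcyc w
    exact ⟨⟨Φ' q, ⟨q, rfl⟩⟩, hk₀ q _⟩
  have : Module.Finite F (LinearMap.range Φ') :=
    Module.Finite.of_injective ((LinearMap.range Φ').subtype.restrictScalars F)
      Subtype.val_injective
  have htop : (LinearMap.range Φ').restrictScalars F = ⊤ := by
    refine Submodule.eq_top_of_finrank_eq (le_antisymm (Submodule.finrank_le _) ?_)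
    exact LinearMap.finrank_le_finrank_of_surjective hk₀surj
  have hΦ'surj : ∀ v, ∃ p, Φ' p = v := by
    intro v
    have : v ∈ (LinearMap.range Φ').restrictScalars F := htop ▸ Submodule.mem_top
    exact this
  let k : Module.End E V := k₀ ∘ₗ LinearMap.codRestrict (LinearMap.range Φ') LinearMap.id hΦ'surj
  have hk : ∀ p : E[X], k (aeval S' p P.e) = aeval S p P.e := fun p => hk₀ p _
  obtain ⟨g, hg⟩ := P.exists_mem_H k (fun v w => by
    obtain ⟨p, rfl⟩ := hΦ'surj v
    obtain ⟨q, rfl⟩ := hΦ'surj w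
    rw [hΦ', evalAt_apply, evalAt_apply, hk, hk, hform]) (by simpa using hk 1)
  have hcomm : S * P.opG g = P.opG g * S' := by
    ext v
    obtain ⟨p, rfl⟩ := hΦ'surj v
    have h1 : S' (aeval S' p P.e) = aeval S' (X * p : E[X]) P.e := by rw [map_mul, aeval_X]; rfl
    rw [hg, hΦ', evalAt_apply, Module.End.mul_apply, Module.End.mul_apply, hk, h1, hk, map_mul,
      aeval_X, Module.End.mul_apply]
  have h2 : g • ξ = τ := P.eq_of_represents (P.represents_smul hξ hcomm) hτ
  exact ⟨g⁻¹, by rw [← h2]; exact inv_smul_smul g ξ⟩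

theorem isStable_of_isCyclicVector {S : Module.End E V} (hS : P.space.IsHerm S)
    {τ : ImaginaryDual F P.𝔤} (h : Represents P.realization S τ) (hcyc : IsCyclicVector S P.e) :
    P.IsStable τ := by
  constructor
  · have : Subsingleton (MulAction.stabilizer P.H τ) := ⟨fun a b => Subtype.ext (by
      rw [P.eq_one_of_smul_eq hS h hcyc a.2, P.eq_one_of_smul_eq hS h hcyc b.2])⟩
    infer_instance
  · choose p hp using fun n => P.exists_polynomial n P.e P.e
    refine ⟨Set.range fun n => p n - MvPolynomial.C (P.space.traceForm P.e ((S ^ n) P.e)), ?_⟩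
    ext ξ
    simp only [Set.mem_ofPred_eq, Set.forall_mem_range, map_sub, MvPolynomial.eval_C, sub_eq_zero]
    constructor
    · rintro ⟨g, rfl⟩ n
      have h1 := P.represents_conj h (g : P.G)
      have h2 := P.isHerm_conj hS (g : P.G)
      refine (hp n _ (g • τ) h2 h1).trans ?_
      have hpow : ∀ n, (P.opG g * S * P.opG (g : P.G)⁻¹) ^ n * P.opG g = P.opG g * S ^ n := by
        intro n
        induction n with
        | zero => simp
        | succ n ih =>
          rw [pow_succ, mul_assoc, mul_assoc _ (P.opG (g : P.G)⁻¹), P.opG_inv_mul, mul_one,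
            ← mul_assoc, ih, mul_assoc, pow_succ]
      have h3 := LinearMap.congr_fun (hpow n) P.e
      rw [Module.End.mul_apply, Module.End.mul_apply, opG_H_e] at h3
      have h4 := P.opG_form g P.e ((S ^ n) P.e)
      rw [opG_H_e] at h4
      rw [h3, traceForm_apply, traceForm_apply, h4]
    · intro hξ
      obtain ⟨S', hS', h'⟩ := exists_represents P.realization ξ
      exact P.mem_orbit_of_traceForm_eq hS hS' h h' hcyc fun n => by rw [← hp n S' ξ hS' h', hξ]

end UnitaryGGPPair

namespace UnitaryGGPPair

open HermitianSpace Polynomial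

variable {F E V : Type*} [RCLike F] [CommRing E] [Algebra F E]
    [Algebra.IsQuadraticExtension F E] [Algebra.Etale F E]
    [AddCommGroup V] [Module E V] [Module F V] [IsScalarTower F E V]
    (P : UnitaryGGPPair F E V) [Module.Finite F V]

/-! ### Stable elements have `e` as a cyclic vector -/

/-- The Cayley transform `(t + δ) / (t - δ)`, an element of norm one. It is encoded as
`(t + δ) ^ 2 / (t ^ 2 - d)` with a division in `F`, and is `0` in the excluded case `t ^ 2 = d`. -/
noncomputable def cayley (t : F) : E :=
  algebraMap F E (t ^ 2 - P.space.d)⁻¹ * (algebraMap F E t + P.space.δ) ^ 2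

theorem sub_mul_cayley {t : F} (ht : t ^ 2 - P.space.d ≠ 0) :
    (algebraMap F E t - P.space.δ) * P.cayley t = algebraMap F E t + P.space.δ := by
  have h1 : algebraMap F E (t ^ 2 - P.space.d)⁻¹ * algebraMap F E (t ^ 2 - P.space.d) = 1 := by
    rw [← map_mul, inv_mul_cancel₀ ht, map_one]
  have h2 := P.space.δ_mul_δ
  rw [map_sub, map_pow] at h1
  rw [cayley]
  linear_combination (algebraMap F E t + P.space.δ) * h1 - algebraMap F E (t ^ 2 - P.space.d)⁻¹ *
    (algebraMap F E t + P.space.δ) * h2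

theorem ι_cayley_mul_cayley {t : F} (ht : t ^ 2 - P.space.d ≠ 0) :
    P.space.ι (P.cayley t) * P.cayley t = 1 := by
  have h1 : algebraMap F E (t ^ 2 - P.space.d)⁻¹ * algebraMap F E (t ^ 2 - P.space.d) = 1 := by
    rw [← map_mul, inv_mul_cancel₀ ht, map_one]
  have h3 := P.sub_mul_cayley ht
  have h2 := P.space.δ_mul_δ
  rw [map_sub, map_pow] at h1
  have h4 : P.space.ι (P.cayley t) = algebraMap F E (t ^ 2 - P.space.d)⁻¹ *
      (algebraMap F E t - P.space.δ) ^ 2 := by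
    rw [cayley, map_mul, map_pow, map_add, AlgEquiv.commutes, AlgEquiv.commutes, P.space.ι_δ,
      ← sub_eq_add_neg]
  rw [h4]
  linear_combination algebraMap F E (t ^ 2 - P.space.d)⁻¹ * (algebraMap F E t - P.space.δ) * h3 +
    h1 - algebraMap F E (t ^ 2 - P.space.d)⁻¹ * h2

theorem eq_of_cayley_smul_eq {s t : F} (hs : s ^ 2 - P.space.d ≠ 0) (ht : t ^ 2 - P.space.d ≠ 0)
    {v : V} (hv : v ≠ 0) (h : P.cayley s • v = P.cayley t • v) : s = t := by
  have h1 := congrArg (((algebraMap F E s - P.space.δ) * (algebraMap F E t - P.space.δ)) • ·) h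
  simp only [smul_smul] at h1
  have h2 : (algebraMap F E s - P.space.δ) * (algebraMap F E t - P.space.δ) * P.cayley s =
      (algebraMap F E t - P.space.δ) * (algebraMap F E s + P.space.δ) := by
    linear_combination (algebraMap F E t - P.space.δ) * P.sub_mul_cayley hs
  have h3 : (algebraMap F E s - P.space.δ) * (algebraMap F E t - P.space.δ) * P.cayley t =
      (algebraMap F E s - P.space.δ) * (algebraMap F E t + P.space.δ) := by
    linear_combination (algebraMap F E s - P.space.δ) * P.sub_mul_cayley ht
  rw [h2, h3, ← sub_eq_zero, ← sub_smul] at h1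
  have h4 : (algebraMap F E t - P.space.δ) * (algebraMap F E s + P.space.δ) -
      (algebraMap F E s - P.space.δ) * (algebraMap F E t + P.space.δ) =
      P.space.δ * algebraMap F E (2 * (t - s)) := by
    rw [map_mul, map_sub, map_ofNat]
    ring
  rw [h4, mul_smul] at h1
  have h5 := δ_smul_eq_zero (𝓗 := P.space) h1
  rw [algebraMap_smul, smul_eq_zero] at h5
  have h6 := (mul_eq_zero.1 (h5.resolve_right hv)).resolve_left two_ne_zero
  exact (sub_eq_zero.1 h6).symm

theorem infinite_setOf_sq_sub_ne_zero : Set.Infinite {t : F | t ^ 2 - P.space.d ≠ 0} := by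
  have h1 : {t : F | t ^ 2 - P.space.d ≠ 0}ᶜ = {t : F | t ^ 2 - P.space.d = 0} := by
    ext t; simp
  have h2 : Set.Finite {t : F | t ^ 2 - P.space.d = 0} := by
    refine (Polynomial.finite_setOfPred_isRoot (p := X ^ 2 - C P.space.d)
      (Polynomial.X_pow_sub_C_ne_zero two_pos _)).subset fun t ht => ?_
    simpa [IsRoot] using ht
  rw [← compl_compl {t : F | t ^ 2 - P.space.d ≠ 0}, h1]
  exact h2.infinite_compl

/-- If the form is nondegenerate on a proper `S`-stable submodule containing `e`, then `τ` is
stabilized by the scalars of norm one on the orthogonal complement. -/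
theorem infinite_stabilizer {S : Module.End E V} (hS : P.space.IsHerm S) {τ : ImaginaryDual F P.𝔤}
    (h : Represents P.realization S τ) {W : Submodule E V} (heW : P.e ∈ W)
    (hSW : ∀ w ∈ W, S w ∈ W) (hW : W ≠ ⊤) (hdisj : Disjoint W (P.space.orth W)) :
    Infinite (MulAction.stabilizer P.H τ) := by
  have hcompl := P.space.isCompl_orth hdisj
  have hSW' : ∀ y ∈ P.space.orth W, S y ∈ P.space.orth W := fun y hy w hw => by
    rw [← hS, hy _ (hSW w hw)]
  obtain ⟨v₀, hv₀, hv₀0⟩ := Submodule.exists_mem_ne_zero_of_ne_bot (P.space.orth_ne_bot hW)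
  let ρ : Module.End E V := (P.space.orth W).projection W hcompl.symm
  have hρW : ∀ w ∈ W, ρ w = 0 := fun w hw => by
    simpa [ρ] using hw
  have hρW' : ∀ y ∈ P.space.orth W, ρ y = y := fun y hy => by
    simpa [ρ] using Submodule.projection_apply_left hcompl.symm ⟨y, hy⟩
  have hdec : ∀ v, ∃ w ∈ W, ∃ y ∈ P.space.orth W, w + y = v := fun v =>
    Submodule.mem_sup.1 (hcompl.sup_eq_top ▸ Submodule.mem_top : v ∈ _)
  have hon : ∀ w ∈ W, ∀ y ∈ P.space.orth W, P.space.form y w = 0 := fun w hw y hy => by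
    rw [← P.space.hermitian, hy w hw, map_zero]
  let g : E → Module.End E V := fun a => 1 + (a - 1) • ρ
  have hg1 : ∀ a, ∀ w ∈ W, g a w = w := fun a w hw => by simp [g, hρW w hw]
  have hg2 : ∀ a, ∀ y ∈ P.space.orth W, g a y = a • y := fun a y hy => by
    simp [g, hρW' y hy, sub_smul]
  have hform : ∀ t, t ^ 2 - P.space.d ≠ 0 → ∀ v w,
      P.space.form (g (P.cayley t) v) (g (P.cayley t) w) = P.space.form v w := by
    intro t ht v w
    obtain ⟨v₁, hv₁, v₂, hv₂, rfl⟩ := hdec v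
    obtain ⟨w₁, hw₁, w₂, hw₂, rfl⟩ := hdec w
    simp only [map_add, LinearMap.add_apply, hg1 _ v₁ hv₁, hg1 _ w₁ hw₁, hg2 _ v₂ hv₂,
      hg2 _ w₂ hw₂, form_smul_left, form_smul_right, hon w₁ hw₁ v₂ hv₂, hw₂ v₁ hv₁]
    linear_combination P.space.form v₂ w₂ * P.ι_cayley_mul_cayley ht
  have hcomm : ∀ a, Commute S (g a) := by
    intro a
    ext v
    obtain ⟨v₁, hv₁, v₂, hv₂, rfl⟩ := hdec v
    simp only [Module.End.mul_apply, map_add, hg1 _ v₁ hv₁, hg2 _ v₂ hv₂,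
      hg1 _ _ (hSW v₁ hv₁), hg2 _ _ (hSW' v₂ hv₂), map_smul]
  have hex : ∀ t : {t : F | t ^ 2 - P.space.d ≠ 0}, ∃ k : MulAction.stabilizer P.H τ,
      P.opG (k : P.H) = g (P.cayley t) := by
    rintro ⟨t, ht⟩
    obtain ⟨k, hk⟩ := P.exists_mem_H _ (hform t ht) (hg1 _ _ heW)
    exact ⟨⟨k, P.smul_eq_self h (by rw [hk]; exact hcomm _)⟩, hk⟩
  choose k hk using hex
  have := P.infinite_setOf_sq_sub_ne_zero.to_subtype
  refine Infinite.of_injective k fun s t hst => Subtype.ext ?_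
  refine P.eq_of_cayley_smul_eq s.2 t.2 hv₀0 ?_
  rw [← hg2 _ v₀ hv₀, ← hg2 _ v₀ hv₀, ← hk, ← hk, hst]

/-- If the stabilizer of `τ` in `H` is finite, then so is that of any element of its orbit. -/
theorem finite_stabilizer_of_mem_orbit {τ ξ : ImaginaryDual F P.𝔤}
    (h : Finite (MulAction.stabilizer P.H τ)) (hξ : ξ ∈ MulAction.orbit P.H τ) :
    Finite (MulAction.stabilizer P.H ξ) := by
  obtain ⟨g, rfl⟩ := hξ
  change Finite (MulAction.stabilizer P.H (g • τ))
  rw [MulAction.stabilizer_smul_eq_stabilizer_map_conj]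
  exact Finite.of_surjective _
    ((MulAut.conj g).toMonoidHom.subgroupMap_surjective (MulAction.stabilizer P.H τ))

/-- A grading of `V` by a one-parameter subgroup of `H`: for an isotropic submodule `R` of `V_H`
there is an idempotent `π` with image `R`, killing `e`, whose adjoint `π'` is orthogonal to it. The
one-parameter subgroup acts by `t` on the image of `π`, by `t⁻¹` on the image of `π'` and trivially
on the rest. -/
theorem exists_idempotent (R : Submodule E V) (hiso : ∀ v ∈ R, ∀ w ∈ R, P.space.form v w = 0)
    (he : ∀ v ∈ R, P.form P.e v = 0) : ∃ π π' : Module.End E V,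
      (∀ v w, P.space.form (π' v) w = P.space.form v (π w)) ∧ (∀ v, π v ∈ R) ∧
      (∀ v ∈ R, π v = v) ∧ π * π = π ∧ π' * π' = π' ∧ π * π' = 0 ∧ π' * π = 0 ∧ π P.e = 0 ∧
      π' P.e = 0 := by
  have : IsReduced E := Algebra.FormallyUnramified.isReduced_of_field F E
  have : Module.Finite F E := Module.finite_of_finrank_pos (R := F)
    (by rw [Algebra.IsQuadraticExtension.finrank_eq_two F E]; norm_num)
  have : IsArtinianRing E := IsArtinianRing.of_finite F E
  have : IsSemisimpleRing E := IsArtinianRing.isSemisimpleRing_of_isReduced E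
  have : IsSemisimpleModule E V := inferInstance
  obtain ⟨R', hR'⟩ := exists_isCompl R
  let A : Module.End E V := R.projection R' hR' ∘ₗ P.VH.subtype ∘ₗ P.projH
  have hAR : ∀ v, A v ∈ R := fun v => by simp [A]
  have hAid : ∀ v ∈ R, A v = v := fun v hv => by
    have h1 : v ∈ P.VH := (P.mem_VH_iff v).2 (he v hv)
    have h2 : (P.projH v : V) = v := congrArg Subtype.val (P.projH_coe ⟨v, h1⟩)
    simp only [A, LinearMap.comp_apply, Submodule.subtype_apply, h2]
    exact Submodule.projection_apply_left hR' ⟨v, hv⟩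
  have hAe : A P.e = 0 := by
    simp only [A, LinearMap.comp_apply, projH_e, map_zero]
  set B := P.space.adjoint A with hB
  have hAA : A * A = A := by ext v; exact hAid _ (hAR v)
  have hBB : B * B = B := by rw [hB, ← adjoint_mul, hAA]
  have hBA : B * A = 0 := P.space.eq_of_form fun v w => by
    rw [Module.End.mul_apply, form_adjoint_left, hiso _ (hAR v) _ (hAR w), LinearMap.zero_apply,
      map_zero, LinearMap.zero_apply]
  have hBe : B P.e = 0 := P.space.separating _ fun w => by
    rw [form_adjoint_left]; exact he _ (hAR w)
  have hABsa : ∀ v w, P.space.form (A (B v)) w = P.space.form v (A (B w)) := fun v w => by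
    rw [hB, ← form_adjoint_right, form_adjoint_left]
  have hAAB : A * (A * B) = A * B := by rw [← mul_assoc, hAA]
  have hBAB : B * (A * B) = 0 := by rw [← mul_assoc, hBA, zero_mul]
  -- `A` projects onto `R`, and `B A = 0` because `R` is isotropic. Subtracting the self-adjoint
  -- operator `A B / 2` from `A` and from `B` makes the other product vanish too.
  refine ⟨A - (2⁻¹ : F) • (A * B), B - (2⁻¹ : F) • (A * B), fun v w => ?_, fun v => ?_,
    fun v hv => ?_, ?_, ?_, ?_, ?_, ?_, ?_⟩
  · simp only [LinearMap.sub_apply, LinearMap.smul_apply, Module.End.mul_apply, map_sub,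
      form_smul_left_base, form_smul_right_base, hABsa]
    rw [hB, form_adjoint_left]
  · exact sub_mem (hAR v) ((R.restrictScalars F).smul_mem _ (hAR _))
  · have h1 : B v = 0 := by
      rw [← hAid v hv]; exact LinearMap.congr_fun hBA v
    rw [LinearMap.sub_apply, LinearMap.smul_apply, Module.End.mul_apply, h1, map_zero, smul_zero,
      sub_zero, hAid v hv]
  · simp only [sub_mul, mul_sub, smul_mul_assoc, mul_smul_comm, mul_assoc, hAA, hAAB, hBA, hBAB,
      mul_zero, smul_zero, sub_zero]
  · simp only [sub_mul, mul_sub, smul_mul_assoc, mul_smul_comm, mul_assoc, hBB, hBAB,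
      mul_zero, smul_zero, sub_zero]
  · simp only [sub_mul, mul_sub, smul_mul_assoc, mul_smul_comm, mul_assoc, hAAB, hBB, hBAB,
      mul_zero, smul_zero, sub_zero]
    rw [sub_sub, ← add_smul]
    norm_num
  · simp only [sub_mul, mul_sub, smul_mul_assoc, mul_smul_comm, mul_assoc, hBA, hBAB,
      mul_zero, smul_zero, sub_zero]
  · simp [hAe, hBe]
  · simp [hBe]

/-- If there is a nonzero isotropic `S`-stable submodule orthogonal to `e`, then the orbit of `τ` is
not closed or the stabilizer is not finite: a one-parameter subgroup of `H` contracts `τ` to an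
element which it stabilizes. -/
theorem not_isStable_of_isotropic {S : Module.End E V} (hS : P.space.IsHerm S)
    {τ : ImaginaryDual F P.𝔤} (h : Represents P.realization S τ) {R : Submodule E V} (hR : R ≠ ⊥)
    (hiso : ∀ v ∈ R, ∀ w ∈ R, P.space.form v w = 0) (he : ∀ v ∈ R, P.form P.e v = 0)
    (hSR : ∀ v ∈ R, S v ∈ R) : ¬ P.IsStable τ := by
  rintro ⟨hfin, T, hT⟩
  obtain ⟨π, π', hadj, hπR, hπid, hππ, hπ'π', hππ', hπ'π, hπe, hπ'e⟩ :=
    P.exists_idempotent R hiso he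
  set μ : Module.End E V := 1 - π - π' with hμ
  have hadj' : ∀ v w, P.space.form (π v) w = P.space.form v (π' w) := fun v w => by
    rw [← P.space.hermitian, ← hadj, P.space.hermitian]
  -- The one-parameter subgroup of `H`.
  let l : F → Module.End E V := fun t => μ + t • π + t⁻¹ • π'
  have hμπ : μ * π = 0 := by rw [hμ, sub_mul, sub_mul, one_mul, hππ, hπ'π, sub_self, sub_zero]
  have hμπ' : μ * π' = 0 := by
    rw [hμ, sub_mul, sub_mul, one_mul, hππ', hπ'π', sub_zero, sub_self]
  have hπμ : π * μ = 0 := by rw [hμ, mul_sub, mul_sub, mul_one, hππ, hππ', sub_self, sub_zero]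
  have hπ'μ : π' * μ = 0 := by
    rw [hμ, mul_sub, mul_sub, mul_one, hπ'π, hπ'π', sub_zero, sub_self]
  have hμμ : μ * μ = μ := by
    conv_lhs => rw [hμ, sub_mul, sub_mul, one_mul, hπμ, hπ'μ, sub_zero, sub_zero]
  have hlμ : ∀ t, l t * μ = μ := fun t => by
    simp only [l, add_mul, smul_mul_assoc, hμμ, hπμ, hπ'μ, smul_zero, add_zero]
  have hlπ : ∀ t, l t * π = t • π := fun t => by
    simp only [l, add_mul, smul_mul_assoc, hμπ, hππ, hπ'π, smul_zero, add_zero, zero_add]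
  have hlπ' : ∀ t, l t * π' = t⁻¹ • π' := fun t => by
    simp only [l, add_mul, smul_mul_assoc, hμπ', hππ', hπ'π', smul_zero, zero_add]
  have hμl : ∀ t, μ * l t = μ := fun t => by
    simp only [l, mul_add, mul_smul_comm, hμμ, hμπ, hμπ', smul_zero, add_zero]
  have hπl : ∀ t, π * l t = t • π := fun t => by
    simp only [l, mul_add, mul_smul_comm, hπμ, hππ, hππ', smul_zero, add_zero, zero_add]
  have hπ'l : ∀ t, π' * l t = t⁻¹ • π' := fun t => by
    simp only [l, mul_add, mul_smul_comm, hπ'μ, hπ'π, hπ'π', smul_zero, zero_add]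
  have hone : μ + π + π' = 1 := by rw [hμ]; abel
  have hll : ∀ t, t ≠ 0 → l t⁻¹ * l t = 1 := fun t ht => by
    conv_lhs => rw [show l t⁻¹ = μ + t⁻¹ • π + t⁻¹⁻¹ • π' from rfl]
    rw [add_mul, add_mul, smul_mul_assoc, smul_mul_assoc, hμl, hπl, hπ'l, smul_smul, smul_smul,
      inv_inv, inv_mul_cancel₀ ht, mul_inv_cancel₀ ht, one_smul, one_smul, hone]
  have hladj : ∀ t v w, P.space.form (l t v) w = P.space.form v (l t⁻¹ w) := by
    intro t v w
    simp only [l, hμ, LinearMap.add_apply, LinearMap.sub_apply, LinearMap.smul_apply, map_add,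
      map_sub, form_smul_left_base, form_smul_right_base, hadj, hadj', Module.End.one_apply,
      inv_inv]
    ring
  have hlform : ∀ t, t ≠ 0 → ∀ v w, P.space.form (l t v) (l t w) = P.space.form v w := by
    intro t ht v w
    rw [hladj, ← Module.End.mul_apply, hll t ht, Module.End.one_apply]
  have hle : ∀ t, l t P.e = P.e := fun t => by
    simp [l, hμ, hπe, hπ'e]
  -- `S` preserves the filtration `0 ⊆ R ⊆ Rᗮ ⊆ V`.
  have hSπ : π * S * π = S * π := by
    ext v
    exact hπid _ (hSR _ (hπR v))
  have hSπ' : π' * S * π' = π' * S := P.space.eq_of_form fun v w => by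
    have h1 := LinearMap.congr_fun hSπ w
    simp only [Module.End.mul_apply] at h1 ⊢
    rw [hadj, hS, hadj, h1, ← hS, ← hadj]
  have hπ'Sπ : π' * S * π = 0 := by
    rw [mul_assoc, ← hSπ, mul_assoc, ← mul_assoc, hπ'π, zero_mul]
  have hμSπ : μ * S * π = 0 := by
    rw [hμ, sub_mul, sub_mul, sub_mul, sub_mul, one_mul, hSπ, hπ'Sπ, sub_self, sub_zero]
  have hπ'Sμ : π' * S * μ = 0 := by
    rw [hμ, mul_sub, mul_sub, mul_one, hSπ', hπ'Sπ, sub_zero, sub_self]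
  -- The components of weights `0`, `1` and `2`: `l t` conjugates `S` to `S₀ + t S₁ + t² S₂`.
  set S₀ := μ * S * μ + π * S * π + π' * S * π' with hS₀
  set S₁ := μ * S * π' + π * S * μ with hS₁
  set S₂ := π * S * π' with hS₂
  have hSdec : S = S₀ + S₁ + S₂ := by
    have h1 : S = (μ + π + π') * S * (μ + π + π') := by rw [hone, one_mul, mul_one]
    conv_lhs => rw [h1]
    simp only [add_mul, mul_add, hμSπ, hπ'Sμ, hπ'Sπ, hS₀, hS₁, hS₂]
    abel
  have hS₀l : ∀ t, S₀ * l t = l t * S₀ := by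
    intro t
    simp only [hS₀, add_mul, mul_add, mul_assoc, hμl, hπl, hπ'l, mul_smul_comm]
    simp only [← mul_assoc, hlμ, hlπ, hlπ', smul_mul_assoc]
  have hSt : ∀ t, t ≠ 0 → (S₀ + t • S₁ + t ^ 2 • S₂) * l t = l t * S := by
    intro t ht
    have h1 : l t * S = l t * S₀ + l t * S₁ + l t * S₂ := by
      conv_lhs => rw [hSdec, mul_add, mul_add]
    have h2 : t • S₁ * l t = l t * S₁ := by
      simp only [hS₁, smul_add, add_mul, mul_add, smul_mul_assoc, mul_assoc, hμl, hπ'l,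
        mul_smul_comm, smul_smul, mul_inv_cancel₀ ht, one_smul]
      simp only [← mul_assoc, hlμ, hlπ, smul_mul_assoc]
    have h3 : t ^ 2 • S₂ * l t = l t * S₂ := by
      have h4 : t ^ 2 * t⁻¹ = t := by field_simp
      simp only [hS₂, smul_mul_assoc, mul_assoc, hπ'l, mul_smul_comm, smul_smul, h4]
      simp only [← mul_assoc, hlπ, smul_mul_assoc]
    rw [add_mul, add_mul, h1, h2, h3, hS₀l t]
  have hk : ∀ t : Fˣ, ∃ k : P.H, P.opG k = l t := fun t =>
    P.exists_mem_H _ (hlform t t.ne_zero) (hle t)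
  choose k hk using hk
  have hrep : ∀ t : Fˣ, Represents P.realization (S₀ + (t : F) • S₁ + (t : F) ^ 2 • S₂)
      (k t • τ) := fun t => P.represents_smul (g := (k t : P.G)) h (by
    rw [hk]; exact hSt t t.ne_zero)
  obtain ⟨ξ, hξ⟩ := exists_represented P.realization S₀
  -- A polynomial vanishing on the orbit vanishes at the limit `ξ` of `k t • τ` as `t → 0`.
  have hmem : ξ ∈ MulAction.orbit P.H τ := by
    rw [hT]
    intro p hp
    let ℓ : Module.End E V → P.𝔤 → F := fun A y =>
      traceF F (P.space.δ • A * P.realization.toEnd y)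
    let c : P.𝔤 → F[X] := fun y => C (ℓ S₀ y) + C (ℓ S₁ y) * X + C (ℓ S₂ y) * X ^ 2
    have hf' : ∀ (q : MvPolynomial P.𝔤 F) (t : F), (MvPolynomial.aeval c q).eval t =
        MvPolynomial.eval (fun y => (c y).eval t) q := by
      intro q t
      induction q using MvPolynomial.induction_on with
      | C a => simp
      | add q r hq hr => rw [map_add, map_add, eval_add, hq, hr]
      | mul_X q y hq => rw [map_mul, map_mul, eval_mul, hq, MvPolynomial.aeval_X,
          MvPolynomial.eval_X]
    let f : F[X] := MvPolynomial.aeval c p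
    have hf : ∀ t : F, f.eval t = MvPolynomial.eval (fun y => (c y).eval t) p := hf' p
    have hf0 : ∀ t : Fˣ, f.eval (t : F) = 0 := by
      intro t
      have h1 : (fun y => (k t • τ).toDual y) = fun y => (c y).eval (t : F) := by
        funext y
        rw [hrep t]
        simp only [c, ℓ, eval_add, eval_mul, eval_C, eval_X, eval_pow, smul_add, add_mul, map_add,
          smul_comm P.space.δ, smul_mul_assoc, map_smul, smul_eq_mul]
        ring
      rw [hf, ← h1]
      have h2 : k t • τ ∈ MulAction.orbit P.H τ := ⟨k t, rfl⟩
      rw [hT] at h2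
      exact h2 p hp
    have hf1 : f = 0 := by
      have : X * f = 0 := Polynomial.funext fun t => by
        rw [eval_mul, eval_X, eval_zero]
        by_cases ht : t = 0
        · rw [ht, zero_mul]
        · rw [show f.eval t = 0 from hf0 (Units.mk0 t ht), mul_zero]
      exact (mul_eq_zero.1 this).resolve_left X_ne_zero
    have h3 : (fun y => ξ.toDual y) = fun y => (c y).eval 0 := by
      funext y
      rw [hξ]
      simp [c, ℓ]
    rw [h3, ← hf, hf1, eval_zero]
  have hfin' := P.finite_stabilizer_of_mem_orbit hfin hmem
  obtain ⟨v, hv, hv0⟩ := Submodule.exists_mem_ne_zero_of_ne_bot hR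
  have hlv : ∀ t, l t v = t • v := fun t => by
    have := LinearMap.congr_fun (hlπ t) v
    rwa [Module.End.mul_apply, LinearMap.smul_apply, hπid v hv] at this
  let κ : Fˣ → MulAction.stabilizer P.H ξ := fun t => ⟨k t, P.smul_eq_self hξ (by
    rw [hk]; exact hS₀l t)⟩
  have hκ : Function.Injective κ := by
    intro s t hst
    have h1 : k s = k t := congrArg Subtype.val hst
    have h2 : (s : F) • v = (t : F) • v := by rw [← hlv, ← hlv, ← hk, ← hk, h1]
    exact Units.ext (smul_left_injective F hv0 h2)
  have hinf : Infinite Fˣ := Infinite.of_injective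
    (fun n : ℕ => Units.mk0 ((n : F) + 1) (Nat.cast_add_one_ne_zero n))
    fun m n hmn => by simpa using congrArg Units.val hmn
  exact (Infinite.of_injective κ hκ).not_finite hfin'

/-- If `τ` is stable, then `W = E[S] e` is all of `V`: its radical `W ∩ Wᗮ` vanishes by
`not_isStable_of_isotropic`, and then `W` is not proper by `infinite_stabilizer`. -/
theorem isCyclicVector_of_isStable {S : Module.End E V} (hS : P.space.IsHerm S)
    {τ : ImaginaryDual F P.𝔤} (h : Represents P.realization S τ) (hst : P.IsStable τ) :
    IsCyclicVector S P.e := by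
  set W := LinearMap.range (evalAt S P.e) with hW
  have heW : P.e ∈ W := ⟨1, by simp [evalAt_apply]⟩
  have hSW : ∀ w ∈ W, S w ∈ W := by
    rintro _ ⟨q, rfl⟩
    exact ⟨X * q, by rw [evalAt_apply, map_mul, aeval_X]; rfl⟩
  have hSW' : ∀ y ∈ P.space.orth W, S y ∈ P.space.orth W := fun y hy w hw => by
    rw [← hS, hy _ (hSW w hw)]
  have hdisj : Disjoint W (P.space.orth W) := by
    rw [disjoint_iff]
    by_contra hR
    exact P.not_isStable_of_isotropic hS h hR (fun v hv w hw => hw.2 v hv.1)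
      (fun v hv => hv.2 P.e heW) (fun v hv => ⟨hSW v hv.1, hSW' v hv.2⟩) hst
  have htop : W = ⊤ := by
    by_contra hne
    exact (P.infinite_stabilizer hS h heW hSW hne hdisj).not_finite hst.1
  intro w
  have : w ∈ W := htop ▸ Submodule.mem_top
  exact this

end UnitaryGGPPair

theorem theorem7 {F E V : Type*} [RCLike F] [CommRing E] [Algebra F E]
    [Algebra.IsQuadraticExtension F E] [Algebra.Etale F E]
    [AddCommGroup V] [Module E V] [Module.Finite E V] [Module F V] [IsScalarTower F E V]
    (P : UnitaryGGPPair F E V) (τ : ImaginaryDual F P.𝔤)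
    (z : P.𝔥) (hz : z ∈ LieAlgebra.center F P.𝔥) (hz0 : z ≠ 0) :
    P.IsStable τ ↔
      τ.IsRegular ∧ (P.restr τ).IsRegular ∧ (P.stabilityForm τ z).Nondegenerate := by
  have : Module.Finite F E := Module.finite_of_finrank_pos (R := F)
    (by rw [Algebra.IsQuadraticExtension.finrank_eq_two F E]; norm_num)
  have : Module.Finite F V := Module.Finite.trans E V
  obtain ⟨S, hS, h⟩ := HermitianSpace.exists_represents P.realization τ
  have hSH := P.isHerm_compress hS
  have hH := P.represents_compress h
  rw [h.isRegular_iff hS, hH.isRegular_iff hSH]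
  constructor
  · intro hst
    have hcyc := P.isCyclicVector_of_isStable hS h hst
    exact ⟨⟨_, hcyc⟩, ⟨_, (P.isCyclicVector_iff S).1 hcyc⟩,
      P.stabilityForm_nondegenerate_of_isCyclicVector hS h hz hz0 hcyc⟩
  · rintro ⟨h1, h2, h3⟩
    exact P.isStable_of_isCyclicVector hS h
      (P.isCyclicVector_of_stabilityForm_nondegenerate hS h hz hz0 h1 h2 h3.2)
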